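/- **Setting.** Let $N\ge 1$ and $K\in\mathbb N\cup\{\infty\}$. For $I\in\mathbb N^N$ write $|I|=\sum_j i_j$, $I!=\prod_j i_j!$. For a symmetric $B\in\mathbb R^{N\times N}$ let $B_I$ be the $|I|\times|I|$ matrix in which the $j$-th row and column of $B$ are repeated $i_j$ times, and $\mathrm{Haf}(M)=\frac1{m!2^m}\sum_{\sigma\in S_{2m}}\prod_{j=1}^m M_{\sigma(2j-1),\sigma(2j)}$ for $M$ of size $2m\times 2m$ ($\mathrm{Haf}=1$ for the empty matrix and $0$ for odd size). Let $\mathcal B$ be the space of symmetric $N\times N$ matrices with strictly positive entries and all eigenvalues $\lambda_1,\dots,\lambda_N$ in $(0,1)$; for $B\in\mathcal B$ let $b_{\min}$ be its smallest entry and $d=\prod_j\sqrt{1-\lambda_j^2}$. Let $\mathcal A=\prod_{0\le k\le K}\mathbb R_{\ge0}^{\{|I|=2k\}}$ with the product topology. For $a\in\mathcal A$ put (all sums over $I,J$ of even degree at most $2K$) $$\mu=\sum_I a_I\mathrm{Haf}(B_I),\quad Q^{\mathrm{GBS\text{-}P}}=\frac1d\sum_{I,J}a_Ia_J\,J!\,\frac{\mathrm{Haf}(B_I)}{\mathrm{Haf}(B_J)},\quad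 Q^{\mathrm{MC}}=\sum_{I,J}a_Ia_J\mathrm{Haf}(B_{I+J}).$$ The problem space $\mathcal P\subseteq\mathcal B\times\mathcal A$ consists of the pairs $(B,a)$ with $\mu\ne0$ for which $\mu$, $\sum_I a_I I!/\mathrm{Haf}(B_I)$ and $Q^{\mathrm{MC}}$ are finite, with the subspace topology. For $0<\epsilon,\delta<1$ the guaranteed sample sizes are $$n^{\mathrm{GBS\text{-}P}}_{\mathrm{Haf}}=\frac{Q^{\mathrm{GBS\text{-}P}}-\mu^2}{\delta\epsilon^2\mu^2},\qquad n^{\mathrm{MC}}_{\mathrm{Haf}}=\frac{Q^{\mathrm{MC}}-\mu^2}{\delta\epsilon^2\mu^2}.$$ For $k\ge1$ write $2k=Ns_k+r_k$ with $1\le r_k\le N$, $s_\infty=\infty$, and $m_k=(s_k!)^N(s_k+1)^{r_k}$. Let $\mathrm{Li}_{s,K}(z)=\sum_{k=1}^K z^k/k^s$, $q^-=\min(q,0)$, $$G_{q,K,N}(z)=\sum_{k=1}^{\lfloor N/2\rfloor}\frac{k^q z^{2k}}{(2k)!}+2^{\frac{N-1}2-q^-}\pi^{\frac{N-1}2}N^{q-\frac12}e^{\frac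 N{12}}\,\mathrm{Li}_{0,N}\!\Big(\frac{2z}N\Big)\,\mathrm{Li}_{\frac12-\frac N2-q,\,s_K}\!\Big(\frac{z^N}{N^N}\Big),$$ and $R_{q,K}(z)=\frac{2^{-q}}{2\sqrt\pi}\mathrm{Li}_{\frac12-q,K}(z)$ if $q\ge0$, $R_{q,K}(z)=\frac1{2\sqrt\pi}\mathrm{Li}_{\frac12-2q,K}(z)$ if $q<0$. Let $\zeta,p,\gamma_\alpha,\gamma_\beta,C_G,C_D>0$, $C_R>1$, $q_\alpha,q_\beta\in\mathbb R$. Let $\mathcal B''_{\alpha,\beta}$ be the set of $B\in\mathcal B$ with $$G_{q_\beta,K,N}\big(\sqrt{2\gamma_\beta b_{\min}^{-1}}\big)<C_GN^3,\quad R_{q_\alpha,K}(4\gamma_\alpha b_{\min})>\tfrac1{2\sqrt\pi}(\zeta N^2)^{2q_\alpha-\frac12}C_R^{\zeta N^2},\quad \tfrac1d<C_DN^p,$$ where, if $K=\infty$, also $\sqrt{2\gamma_\beta b_{\min}^{-1}}<N$ and $4\gamma_\alpha b_{\min}<1$, so that $G$ and $R$ are defined. Call $(*)$ the conditions, for all $1\le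 k\le K$, $$\frac{k^{q_\alpha}\gamma_\alpha^k}{k!}\le\sum_{|I|=2k}a_I\le\frac{k^{q_\beta}\gamma_\beta^k}{k!},\qquad \sum_{|I|=2k}a_I\,I!\le\frac{k^{q_\beta}\gamma_\beta^k}{k!}\,m_k .$$ **Theorem.** (1) Let $N\ge1$, $K\ge\zeta N^2$ (possibly $K=\infty$), $0<\epsilon,\delta<1$. If $(B,a)\in\mathcal P$, $B\in\mathcal B''_{\alpha,\beta}$, $a$ satisfies $(*)$ and $a_0\ne0$, then $$n^{\mathrm{GBS\text{-}P}}_{\mathrm{Haf}}<\frac1{\epsilon^2\delta}\Big(C_DN^p+\frac{C_GC_DN^{3+p}}{a_0}-1\Big),$$ $$n^{\mathrm{MC}}_{\mathrm{Haf}}>\frac1{\epsilon^2\delta}\left(\frac{\min(1,a_0)\,\frac{e^{\frac1{25}-\frac16}}{\sqrt\pi}\,(\zeta N^2)^{2q_\alpha-\frac12}C_R^{\zeta N^2}}{\big(C_DN^p(a_0+C_GN^3)\big)^2}-1\right).$$ (2) Fix $\zeta,p,C_G,C_D,C_R$ and $0<l\le u$, and let $q_\alpha=q_\alpha(N)$ be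 such that $C_R^{\zeta N^2}$ dominates $(\zeta N^2)^{2q_\alpha-\frac12}C_R^{\zeta N^2}$, in the sense that $(2q_\alpha(N)-\frac12)\log(\zeta N^2)=o(N^2)$. Then there is $C>0$, and for every $1<\rho<C_R$ there are $c>0$ and $N_0$, such that for all $N\ge N_0$, all $K\ge\zeta N^2$, all $0<\epsilon,\delta<1$, $\gamma_\alpha,\gamma_\beta>0$, $q_\beta$, and all $(B,a)$ as in (1) with $l\le a_0\le u$, $$n^{\mathrm{GBS\text{-}P}}_{\mathrm{Haf}}\le\frac1{\epsilon^2\delta}\,C\,N^{3+p},\qquad n^{\mathrm{MC}}_{\mathrm{Haf}}\ge\frac1{\epsilon^2\delta}\,c\,\rho^{\zeta N^2}.$$ (3) For all $\zeta,p>0$ there are constants $C_G,C_D>0$, $C_R>1$ and sequences $\gamma_\alpha(N),\gamma_\beta(N)>0$, $q_\alpha(N),q_\beta(N)$, with $q_\alpha$ as in (2), such that for all $0<l<u$ there are $C,c>0$ and $N_0$ with the following property. For all $N\ge N_0$ and all finite $K\ge\zeta N^2$ there is a non-empty open subset $U$ of $\mathcal P$ such that every $(B,a)\in U$ satisfies $B\in\mathcal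 B''_{\alpha,\beta}$, $(*)$ and $l<a_0<u$, and, for all $0<\epsilon,\delta<1$, $$n^{\mathrm{GBS\text{-}P}}_{\mathrm{Haf}}\le\frac1{\epsilon^2\delta}\,C\,N^{3+p},\qquad n^{\mathrm{MC}}_{\mathrm{Haf}}\ge\frac1{\epsilon^2\delta}\,c\,C_R^{\zeta N^2};$$ moreover every value in $(l,u)$ is attained as $a_0$ for some $(B,a)\in U$. -/

import Mathlib

open scoped NNReal Topology

namespace GBS

noncomputable section

/-- The hafnian of a square matrix indexed by a finite type `ι`. With `m = ⌊card ι / 2⌋` it is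
`(1 / (m! 2^m)) ∑_σ ∏_{j < m} M (σ (2j)) (σ (2j+1))`, where `σ` runs over the bijections
`{0, …, 2m-1} ≃ ι` (for `ι = Fin (2m)`: the permutations). It is `1` for the empty matrix, and
it is `0` if `card ι` is odd, as there are then no such bijections. -/
def hafnian {ι : Type} [Fintype ι] [DecidableEq ι] (M : Matrix ι ι ℝ) : ℝ :=
  (1 / ((Nat.factorial (Fintype.card ι / 2) : ℝ) * 2 ^ (Fintype.card ι / 2))) *
    ∑ σ : Fin (2 * (Fintype.card ι / 2)) ≃ ι,
      ∏ j : Fin (Fintype.card ι / 2),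
        M (σ ⟨2 * j.1, by have := j.2; omega⟩) (σ ⟨2 * j.1 + 1, by have := j.2; omega⟩)

/-- `Haf(B_I)`: the matrix `B_I` repeats the `i`-th row and column of `B` exactly `I i` times. -/
def hafB {N : ℕ} (B : Matrix (Fin N) (Fin N) ℝ) (I : Fin N → ℕ) : ℝ :=
  hafnian (B.submatrix (Sigma.fst : (Σ i : Fin N, Fin (I i)) → Fin N)
    (Sigma.fst : (Σ i : Fin N, Fin (I i)) → Fin N))

/-- `I! = i₁! ⋯ i_N!`. -/
def mfact {N : ℕ} (I : Fin N → ℕ) : ℝ := ∏ i, (Nat.factorial (I i) : ℝ)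

/-- The multi-indices `I` with `|I| = 2k`. -/
def level (N k : ℕ) : Finset (Fin N → ℕ) := Finset.piAntidiag Finset.univ (2 * k)

/-- The multi-indices `I` with `|I| = 2k` for some `k ≤ K` (`K` a natural number or `∞`). -/
abbrev EvenIdx (N : ℕ) (K : ℕ∞) : Type :=
  {I : Fin N → ℕ // ∃ k : ℕ, (k : ℕ∞) ≤ K ∧ ∑ i, I i = 2 * k}

/-- The space `𝒜 = ∏_{k ≤ K} ℝ_{≥0}^{I : |I| = 2k}` with the product topology. -/
abbrev CoeffSpace (N : ℕ) (K : ℕ∞) : Type := EvenIdx N K → ℝ≥0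

open Classical in
/-- The coefficient `a_I`, read as `0` for multi-indices that do not occur. -/
def coeff {N : ℕ} {K : ℕ∞} (a : CoeffSpace N K) (I : Fin N → ℕ) : ℝ :=
  if h : ∃ k : ℕ, (k : ℕ∞) ≤ K ∧ ∑ i, I i = 2 * k then (a ⟨I, h⟩ : ℝ) else 0

/-- The space `ℬ` of symmetric matrices with strictly positive entries and all eigenvalues
strictly between `0` and `1`. -/
def matrixSpace (N : ℕ) : Set (Matrix (Fin N) (Fin N) ℝ) :=
  {B | (∀ i j, 0 < B i j) ∧ B.IsHermitian ∧ spectrum ℝ B ⊆ Set.Ioo 0 1}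

theorem matrixSpace_isHermitian {N : ℕ} (B : matrixSpace N) :
    (B : Matrix (Fin N) (Fin N) ℝ).IsHermitian := B.2.2.1

/-- The smallest entry of `B`. -/
def bmin {N : ℕ} (B : matrixSpace N) : ℝ :=
  ⨅ p : Fin N × Fin N, (B : Matrix (Fin N) (Fin N) ℝ) p.1 p.2

/-- `d = ∏_j √(1 - λ_j²)` over the eigenvalues `λ_j` of `B`, with multiplicity. -/
def gbsD {N : ℕ} (B : matrixSpace N) : ℝ :=
  ∏ j, √(1 - (matrixSpace_isHermitian B).eigenvalues j ^ 2)

/-- `μ_Haf = ∑_I a_I Haf(B_I)`. -/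
def muHaf {N : ℕ} {K : ℕ∞} (B : matrixSpace N) (a : CoeffSpace N K) : ℝ :=
  ∑' I : Fin N → ℕ, coeff a I * hafB (B : Matrix (Fin N) (Fin N) ℝ) I

/-- `Q^{GBS-P} = (1/d) ∑_{I,J} a_I a_J J! Haf(B_I) / Haf(B_J)`. -/
def qGBSP {N : ℕ} {K : ℕ∞} (B : matrixSpace N) (a : CoeffSpace N K) : ℝ :=
  1 / gbsD B * ∑' p : (Fin N → ℕ) × (Fin N → ℕ),
    coeff a p.1 * coeff a p.2 * mfact p.2 *
      (hafB (B : Matrix (Fin N) (Fin N) ℝ) p.1 / hafB (B : Matrix (Fin N) (Fin N) ℝ) p.2)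

/-- `Q^{MC} = ∑_{I,J} a_I a_J Haf(B_{I+J})`. -/
def qMC {N : ℕ} {K : ℕ∞} (B : matrixSpace N) (a : CoeffSpace N K) : ℝ :=
  ∑' p : (Fin N → ℕ) × (Fin N → ℕ),
    coeff a p.1 * coeff a p.2 * hafB (B : Matrix (Fin N) (Fin N) ℝ) (p.1 + p.2)

/-- The guaranteed sample size of the GBS-P estimator. -/
def nGBSP {N : ℕ} {K : ℕ∞} (ε δ : ℝ) (B : matrixSpace N) (a : CoeffSpace N K) : ℝ :=
  (qGBSP B a - muHaf B a ^ 2) / (δ * ε ^ 2 * muHaf B a ^ 2)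

/-- The guaranteed sample size of the plain Monte Carlo estimator. -/
def nMC {N : ℕ} {K : ℕ∞} (ε δ : ℝ) (B : matrixSpace N) (a : CoeffSpace N K) : ℝ :=
  (qMC B a - muHaf B a ^ 2) / (δ * ε ^ 2 * muHaf B a ^ 2)

/-- The problem space `𝒫`: pairs `(B, a)` with `μ_Haf ≠ 0` for which `μ_Haf`, `Q^{GBS-P}` and
`Q^{MC}` are finite. -/
def problemSpace (N : ℕ) (K : ℕ∞) : Set (matrixSpace N × CoeffSpace N K) :=
  {x | (Summable fun I : Fin N → ℕ =>
          coeff x.2 I * hafB (x.1 : Matrix (Fin N) (Fin N) ℝ) I) ∧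
       muHaf x.1 x.2 ≠ 0 ∧
       (Summable fun I : Fin N → ℕ =>
          coeff x.2 I * mfact I / hafB (x.1 : Matrix (Fin N) (Fin N) ℝ) I) ∧
       (Summable fun p : (Fin N → ℕ) × (Fin N → ℕ) =>
          coeff x.2 p.1 * coeff x.2 p.2 *
            hafB (x.1 : Matrix (Fin N) (Fin N) ℝ) (p.1 + p.2))}

/-- For `k ≥ 1`: the integer `s_k ≥ 0` in `2k = N s_k + r_k` with `1 ≤ r_k ≤ N`. -/
def sNum (N k : ℕ) : ℕ := (2 * k - 1) / N

/-- For `k ≥ 1`: the integer `1 ≤ r_k ≤ N` in `2k = N s_k + r_k`. -/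
def rNum (N k : ℕ) : ℕ := 2 * k - N * sNum N k

theorem sNum_rNum_spec {N k : ℕ} (hN : 1 ≤ N) (hk : 1 ≤ k) :
    2 * k = N * sNum N k + rNum N k ∧ 1 ≤ rNum N k ∧ rNum N k ≤ N := by
  have h1 := Nat.div_add_mod (2 * k - 1) N
  have h2 := Nat.mod_lt (2 * k - 1) hN
  unfold rNum sNum
  omega

/-- `m_k = (s_k!)^N (s_k + 1)^{r_k}`. -/
def mNum (N k : ℕ) : ℝ := (Nat.factorial (sNum N k) : ℝ) ^ N * ((sNum N k : ℝ) + 1) ^ rNum N k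

open Classical in
/-- `s_K`, with `s_∞ = ∞`. -/
def sENat (N : ℕ) (K : ℕ∞) : ℕ∞ := if K = ⊤ then ⊤ else (sNum N K.toNat : ℕ∞)

open Classical in
/-- The (truncated) polylogarithm `Li_{s,K}(z) = ∑_{1 ≤ k ≤ K} z^k / k^s`. -/
def polylog (s : ℝ) (K : ℕ∞) (z : ℝ) : ℝ :=
  ∑' k : ℕ, if 1 ≤ k ∧ (k : ℕ∞) ≤ K then z ^ k / (k : ℝ) ^ s else 0

/-- `h_{q,n}(z) = ∑_{k=1}^n k^q z^{2k} / (2k)!`. -/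
def hFun (q : ℝ) (n : ℕ) (z : ℝ) : ℝ :=
  ∑ k ∈ Finset.Icc 1 n, (k : ℝ) ^ q / (Nat.factorial (2 * k) : ℝ) * z ^ (2 * k)

/-- The function `G_{q,K,N}`; for `K = ∞` it is meant for `|z| < N` only. -/
def gFun (q : ℝ) (K : ℕ∞) (N : ℕ) (z : ℝ) : ℝ :=
  hFun q (N / 2) z +
    (2 : ℝ) ^ (((N : ℝ) - 1) / 2 - min q 0) * Real.pi ^ (((N : ℝ) - 1) / 2) *
      (N : ℝ) ^ (q - 1 / 2) * Real.exp ((N : ℝ) / 12) *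
      polylog 0 (N : ℕ∞) (2 * z / N) *
      polylog (1 / 2 - (N : ℝ) / 2 - q) (sENat N K) (z ^ N / (N : ℝ) ^ N)

open Classical in
/-- The function `R_{q,K}`; for `K = ∞` it is meant for `|z| < 1` only. -/
def rFun (q : ℝ) (K : ℕ∞) (z : ℝ) : ℝ :=
  if 0 ≤ q then (2 : ℝ) ^ (-q) * (1 / (2 * √Real.pi)) * polylog (1 / 2 - q) K z
  else 1 / (2 * √Real.pi) * polylog (1 / 2 - 2 * q) K z

/-- The subset `ℬ''_{α,β}` of `ℬ`, with its constants explicit. The first clause says that, for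
`K = ∞`, the functions `G` and `R` are evaluated inside their domains. -/
def uniformSpace (N : ℕ) (K : ℕ∞) (ζ p γα γβ qα qβ CG CD CR : ℝ) : Set (matrixSpace N) :=
  {B | (K = ⊤ → √(2 * γβ * (bmin B)⁻¹) < (N : ℝ) ∧ 4 * γα * bmin B < 1) ∧
       gFun qβ K N (√(2 * γβ * (bmin B)⁻¹)) < CG * (N : ℝ) ^ 3 ∧
       1 / (2 * √Real.pi) * (ζ * (N : ℝ) ^ 2) ^ (2 * qα - 1 / 2) * CR ^ (ζ * (N : ℝ) ^ 2) <
         rFun qα K (4 * γα * bmin B) ∧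
       1 / gbsD B < CD * (N : ℝ) ^ p}

/-- The growth conditions on the coefficients: for all `1 ≤ k ≤ K`,
`k^{q_α} γ_α^k / k! ≤ ∑_{|I| = 2k} a_I ≤ k^{q_β} γ_β^k / k!` and
`∑_{|I| = 2k} a_I I! ≤ (k^{q_β} γ_β^k / k!) m_k`. -/
def CoeffBounds {N : ℕ} {K : ℕ∞} (γα γβ qα qβ : ℝ) (a : CoeffSpace N K) : Prop :=
  ∀ k : ℕ, 1 ≤ k → (k : ℕ∞) ≤ K →
    (k : ℝ) ^ qα * γα ^ k / (Nat.factorial k : ℝ) ≤ ∑ I ∈ level N k, coeff a I ∧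
    ∑ I ∈ level N k, coeff a I ≤ (k : ℝ) ^ qβ * γβ ^ k / (Nat.factorial k : ℝ) ∧
    ∑ I ∈ level N k, coeff a I * mfact I ≤
      (k : ℝ) ^ qβ * γβ ^ k / (Nat.factorial k : ℝ) * mNum N k

/-- `K ≥ ζ N²`, for `K` a natural number or `∞`. -/
def LargeDegree (ζ : ℝ) (N : ℕ) (K : ℕ∞) : Prop := K = ⊤ ∨ ζ * (N : ℝ) ^ 2 ≤ (K.toNat : ℝ)

/-- `C^{ζN²}` dominates `(ζN²)^{2 q_α - 1/2} C^{ζN²}` as `N → ∞` (for one, equivalently every,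
`C > 1`): the first factor is `exp(o(N²))`. -/
def Dominates (ζ : ℝ) (qα : ℕ → ℝ) : Prop :=
  Filter.Tendsto
    (fun N : ℕ => (2 * qα N - 1 / 2) * Real.log (ζ * (N : ℝ) ^ 2) / (N : ℝ) ^ 2)
    Filter.atTop (𝓝 0)

end

end GBS

open GBS

/-!
The kernel estimate is `Haf(B_I)² ≤ I! / d`. Up to normalization, `Haf(B_I)` is an entry of the
symmetrization of the tensor power `B^{⊗k}`. The squared Euclidean norm of that tensor is invariant
under orthogonal changes of basis; for the diagonal matrix of eigenvalues it is bounded by the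
binomial series of `∏_j (1 - λ_j²)^{-1/2} = 1 / d`. Hence `μ ≤ (1 / d) ∑_I a_I I! / Haf(B_I)`, and
`Q^{GBS-P}` is `μ` times the right-hand side.

In the other direction, `Haf(B_I) ≥ b_min^k (2k)! / (2^k k!)` for `|I| = 2k`, since all entries of
`B` are at least `b_min`. With the growth conditions on `a` and Stirling's formula this bounds
`∑_I a_I I! / Haf(B_I)` by `G` from above and `Q^{MC}` by `R` from below. For the open sets, take
the matrices near a flat matrix with entries of order `1 / N`, and the coefficients near a family
concentrated on the most evenly distributed multi-indices, which minimize `I!`.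
-/

namespace GBS

open Equiv Filter Finset
open scoped Nat

section Words

variable {α ι : Type*} [Fintype α] [DecidableEq ι]

/-- The content of a word `w : α → ι`: the number of occurrences of each letter. Repeating the rows
and columns of a matrix according to a multi-index `I` amounts to reading it along a word of
content `I`. -/
def content (w : α → ι) (i : ι) : ℕ := Fintype.card {a // w a = i}

theorem content_comp_perm (w : α → ι) (σ : Perm α) : content (w ∘ σ) = content w := by
  ext i
  exact Fintype.card_congr (σ.subtypeEquiv fun _ => Iff.rfl)

theorem exists_comp_perm_eq {w v : α → ι} (h : content v = content w) :
    ∃ σ : Perm α, w ∘ σ = v := by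
  have e (i : ι) : {a // v a = i} ≃ {a // w a = i} := Fintype.equivOfCardEq (congrFun h i)
  exact ⟨Equiv.ofFiberEquiv e, funext (Equiv.ofFiberEquiv_map e)⟩

theorem content_le_card (w : α → ι) (i : ι) : content w i ≤ Fintype.card α :=
  Fintype.card_subtype_le _

variable [Fintype ι]

theorem prod_comp_eq_prod_pow_content {M : Type*} [CommMonoid M] (w : α → ι) (f : ι → M) :
    ∏ a, f (w a) = ∏ i, f i ^ content w i := by
  simp_rw [content, Fintype.card_subtype, ← prod_const]
  exact (prod_fiberwise' univ w f).symm

variable [DecidableEq α]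

theorem card_comp_perm_eq {w v : α → ι} (h : content v = content w) :
    #{σ : Perm α | w ∘ σ = v} = ∏ i, (content w i)! := by
  obtain ⟨τ, rfl⟩ := exists_comp_perm_eq h
  have coset_equiv : {σ : Perm α // w ∘ σ = w ∘ τ} ≃ {σ : Perm α // w ∘ σ = w} :=
    (Equiv.mulRight τ⁻¹).subtypeEquiv fun σ => (τ.comp_symm_eq w (w ∘ σ)).symm
  rw [← Fintype.card_subtype, Fintype.card_congr coset_equiv, DomMulAct.stabilizer_card]
  rfl

theorem sum_comp_perm {M : Type*} [AddCommMonoid M] (w : α → ι) (F : (α → ι) → M) :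
    ∑ σ : Perm α, F (w ∘ σ) =
      (∏ i, (content w i)!) • ∑ v with content v = content w, F v := by
  rw [← sum_fiberwise_of_maps_to' (g := fun σ : Perm α => w ∘ σ)
    (t := {v | content v = content w}) (fun σ _ => by simp [content_comp_perm]), smul_sum]
  refine sum_congr rfl fun v hv => ?_
  rw [sum_const, card_comp_perm_eq (mem_filter.mp hv).2]

theorem prod_factorial_mul_card_content (w : α → ι) :
    (∏ i, (content w i)!) * #{v : α → ι | content v = content w} = (Fintype.card α)! := by
  simpa [Fintype.card_perm] using (sum_comp_perm w fun _ => (1 : ℕ)).symm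

theorem card_content_mul_le (m : ι → ℕ) :
    #{w : α → ι | content w = m} * ∏ i, (m i)! ≤ (Fintype.card α)! := by
  obtain hm | ⟨w, hw⟩ := ({w : α → ι | content w = m} : Finset _).eq_empty_or_nonempty
  · simp [hm]
  · obtain rfl := (mem_filter.mp hw).2
    exact (mul_comm _ _).trans_le (prod_factorial_mul_card_content w).le

theorem sum_prod_content_le {f : ι → ℕ → ℝ} (hf : ∀ i m, 0 ≤ f i m) :
    ∑ w : α → ι, ∏ i, f i (content w i) ≤
      (Fintype.card α)! * ∏ i, ∑ m ∈ range (Fintype.card α + 1), f i m / m ! := by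
  have content_mem (w : α → ι) (_ : w ∈ univ) :
      content w ∈ Fintype.piFinset fun _ : ι => range (Fintype.card α + 1) := by
    simp [content_le_card]
  rw [prod_univ_sum, mul_sum, ← sum_fiberwise_of_maps_to' content_mem fun m => ∏ i, f i (m i)]
  refine sum_le_sum fun m _ => ?_
  have hm : (#{w : α → ι | content w = m} : ℝ) * ∏ i, ((m i)! : ℝ) ≤ (Fintype.card α)! := by
    exact_mod_cast card_content_mul_le m
  rw [sum_const, nsmul_eq_mul, prod_div_distrib, ← mul_div_assoc,
    le_div_iff₀ (prod_pos fun i _ => by positivity), mul_right_comm]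
  exact mul_le_mul_of_nonneg_right hm (prod_nonneg fun i _ => hf i _)

end Words

section WordHafnian

/-- The entry at `w` of the `k`-th tensor power of `B`, whose `2k` slots are indexed by
`Fin k × Fin 2`. -/
def pairProd {ι : Type*} {k : ℕ} (B : Matrix ι ι ℝ) (w : Fin k × Fin 2 → ι) : ℝ :=
  ∏ j, B (w (j, 0)) (w (j, 1))

/-- The hafnian of `B` read along the word `w` of length `2k`. Up to the factor `(2k)! / (k! 2^k)`,
this is the entry at `w` of the symmetrization of the `k`-th tensor power of `B`. -/
noncomputable def wordHaf {ι : Type*} {k : ℕ} (B : Matrix ι ι ℝ) (w : Fin k × Fin 2 → ι) : ℝ :=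
  1 / ((k ! : ℝ) * 2 ^ k) * ∑ σ : Perm (Fin k × Fin 2), pairProd B (w ∘ σ)

theorem hafnian_submatrix_eq_wordHaf {ι : Type} {κ : Type*} [Fintype ι] [DecidableEq ι]
    (B : Matrix κ κ ℝ) (w : ι → κ) {k : ℕ} (e : Fin k × Fin 2 ≃ ι) :
    hafnian (B.submatrix w w) = wordHaf B (w ∘ e) := by
  obtain rfl : Fintype.card ι / 2 = k := by simp [← Fintype.card_congr e]
  let pairs (m : ℕ) : Fin m × Fin 2 ≃ Fin (2 * m) :=
    finProdFinEquiv.trans (finCongr (mul_comm m 2))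
  rw [hafnian, wordHaf]
  congr 1
  refine Fintype.sum_equiv ((pairs _).symm.equivCongr e.symm) _ _ fun σ =>
    prod_congr rfl fun j _ => ?_
  simp only [Matrix.submatrix_apply, Function.comp_apply, equivCongr_apply_apply, symm_symm,
    apply_symm_apply]
  congr 3 <;> ext <;> simp [pairs, add_comm]

variable {ι : Type*} {k : ℕ}

theorem wordHaf_comp_perm (B : Matrix ι ι ℝ) (w : Fin k × Fin 2 → ι) (τ : Perm (Fin k × Fin 2)) :
    wordHaf B (w ∘ τ) = wordHaf B w := by
  rw [wordHaf, wordHaf]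
  congr 1
  exact Fintype.sum_equiv (Equiv.mulLeft τ) _ _ fun _ => rfl

variable [Fintype ι]

/-- Symmetrization is an orthogonal projection, so only one of the two factors need be
symmetrized. -/
theorem sum_wordHaf_sq_eq_sum_mul_pairProd (B : Matrix ι ι ℝ) :
    ∑ w : Fin k × Fin 2 → ι, wordHaf B w ^ 2 =
      (2 * k)! / (k ! * 2 ^ k) * ∑ w : Fin k × Fin 2 → ι, wordHaf B w * pairProd B w := by
  have reindex (σ : Perm (Fin k × Fin 2)) :
      ∑ w : Fin k × Fin 2 → ι, wordHaf B (w ∘ σ) * pairProd B (w ∘ σ) =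
        ∑ w : Fin k × Fin 2 → ι, wordHaf B w * pairProd B w :=
    (σ.symm.arrowCongr (Equiv.refl ι)).sum_comp fun w => wordHaf B w * pairProd B w
  have sq_expand (w : Fin k × Fin 2 → ι) : wordHaf B w ^ 2 =
      1 / (k ! * 2 ^ k) * ∑ σ : Perm (Fin k × Fin 2), wordHaf B (w ∘ σ) * pairProd B (w ∘ σ) := by
    simp_rw [wordHaf_comp_perm, ← mul_sum, mul_left_comm, sq]
    rfl
  simp_rw [sq_expand, ← mul_sum]
  rw [sum_comm]
  simp_rw [reindex]
  simp only [sum_const, card_univ, Fintype.card_perm, Fintype.card_prod, Fintype.card_fin,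
    nsmul_eq_mul, mul_comm k 2]
  ring

theorem pairProd_conj (O D : Matrix ι ι ℝ) (x : Fin k × Fin 2 → ι) :
    pairProd (O * D * O.transpose) x =
      ∑ v : Fin k × Fin 2 → ι, (∏ p, O (x p) (v p)) * pairProd D v := by
  have entry (a b : ι) : (O * D * O.transpose) a b =
      ∑ g : Fin 2 → ι, O a (g 0) * O b (g 1) * D (g 0) (g 1) := by
    rw [← (finTwoArrowEquiv ι).symm.sum_comp, Fintype.sum_prod_type_right]
    simp only [Matrix.mul_apply, Matrix.transpose_apply, sum_mul, finTwoArrowEquiv_symm_apply,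
      Matrix.cons_val_zero, Matrix.cons_val_one]
    exact sum_congr rfl fun _ _ => sum_congr rfl fun _ _ => by ring
  simp_rw [pairProd, entry]
  rw [prod_univ_sum, Fintype.piFinset_univ]
  refine Fintype.sum_equiv (Equiv.curry (Fin k) (Fin 2) ι).symm _ _ fun g => ?_
  simp [Fintype.prod_prod_type, Fin.prod_univ_two, prod_mul_distrib]

theorem wordHaf_conj (O D : Matrix ι ι ℝ) (w : Fin k × Fin 2 → ι) :
    wordHaf (O * D * O.transpose) w =
      ∑ v : Fin k × Fin 2 → ι, (∏ p, O (w p) (v p)) * wordHaf D v := by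
  have reindex (σ : Perm (Fin k × Fin 2)) :
      ∑ v : Fin k × Fin 2 → ι, (∏ p, O (w (σ p)) (v p)) * pairProd D v =
        ∑ v : Fin k × Fin 2 → ι, (∏ p, O (w p) (v p)) * pairProd D (v ∘ σ) := by
    refine Fintype.sum_equiv (σ.arrowCongr (Equiv.refl ι)) _ _ fun v => ?_
    rw [← Equiv.prod_comp σ fun p => O (w p) (σ.arrowCongr (Equiv.refl ι) v p)]
    simp [Function.comp_def]
  simp_rw [wordHaf, pairProd_conj, Function.comp_apply, reindex]
  rw [sum_comm]
  simp_rw [← mul_sum, mul_left_comm, ← mul_sum]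

variable [DecidableEq ι]

theorem sum_prod_mul_prod_of_orthogonal {α : Type*} [Fintype α] [DecidableEq α]
    {O : Matrix ι ι ℝ} (hO : O.transpose * O = 1) (v v' : α → ι) :
    ∑ w : α → ι, (∏ a, O (w a) (v a)) * ∏ a, O (w a) (v' a) = if v = v' then 1 else 0 := by
  have column_inner (c c' : ι) : ∑ i, O i c * O i c' = if c = c' then 1 else 0 := by
    rw [← Matrix.one_apply, ← hO, Matrix.mul_apply]
    rfl
  simp_rw [← prod_mul_distrib]
  rw [← Fintype.piFinset_univ, ← prod_univ_sum (fun _ => univ) fun a i => O i (v a) * O i (v' a)]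
  simp_rw [column_inner, prod_ite_zero]
  simp [funext_iff]

theorem sum_wordHaf_sq_conj {O : Matrix ι ι ℝ} (hO : O.transpose * O = 1) (D : Matrix ι ι ℝ) :
    ∑ w : Fin k × Fin 2 → ι, wordHaf (O * D * O.transpose) w ^ 2 =
      ∑ v : Fin k × Fin 2 → ι, wordHaf D v ^ 2 := by
  calc ∑ w : Fin k × Fin 2 → ι, wordHaf (O * D * O.transpose) w ^ 2
      = ∑ w : Fin k × Fin 2 → ι, ∑ v, ∑ v',
          (∏ p, O (w p) (v p)) * (∏ p, O (w p) (v' p)) * (wordHaf D v * wordHaf D v') := by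
        simp_rw [sq, wordHaf_conj, sum_mul_sum, mul_mul_mul_comm]
    _ = ∑ v : Fin k × Fin 2 → ι, ∑ v',
          (if v = v' then 1 else 0) * (wordHaf D v * wordHaf D v') := by
        rw [sum_comm]
        refine sum_congr rfl fun v _ => ?_
        rw [sum_comm]
        simp_rw [← sum_mul, sum_prod_mul_prod_of_orthogonal hO]
    _ = ∑ v : Fin k × Fin 2 → ι, wordHaf D v ^ 2 := by simp [sq]

theorem factorial_mul_wordHaf_sq_le (B : Matrix ι ι ℝ) (w : Fin k × Fin 2 → ι) :
    (2 * k)! * wordHaf B w ^ 2 ≤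
      (∏ i, ((content w i)! : ℝ)) * ∑ v : Fin k × Fin 2 → ι, wordHaf B v ^ 2 := by
  have orbit_sum : ((2 * k)! : ℝ) * wordHaf B w ^ 2 = (∏ i, ((content w i)! : ℝ)) *
      ∑ v : Fin k × Fin 2 → ι with content v = content w, wordHaf B v ^ 2 := by
    have h := sum_comp_perm w fun v => wordHaf B v ^ 2
    simp_rw [wordHaf_comp_perm] at h
    simpa [Fintype.card_perm, mul_comm k 2] using h
  rw [orbit_sum]
  gcongr
  exact subset_univ _

end WordHafnian

theorem centralBinom_eq_factorial_div (n : ℕ) :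
    (n.centralBinom : ℝ) = (2 * n)! / ((n ! : ℝ) * n !) := by
  rw [Nat.centralBinom, Nat.cast_choose ℝ (by lia : n ≤ 2 * n), two_mul, Nat.add_sub_cancel]

theorem multichoose_half_eq (n : ℕ) :
    Ring.multichoose (1 / 2 : ℝ) n = n.centralBinom / 4 ^ n := by
  have h := Ring.factorial_nsmul_multichoose_eq_ascPochhammer (1 / 2 : ℝ) n
  have hn : (n ! : ℝ) ≠ 0 := by positivity
  rw [nsmul_eq_mul, Polynomial.ascPochhammer_smeval_eq_eval] at h
  refine mul_left_cancel₀ hn (h.trans ?_)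
  clear h hn
  induction n with
  | zero => simp
  | succ n ih =>
    have step : ((n : ℝ) + 1) * (n + 1).centralBinom = 2 * (2 * n + 1) * n.centralBinom := by
      exact_mod_cast Nat.succ_mul_centralBinom_succ n
    rw [ascPochhammer_succ_eval, ih, Nat.factorial_succ, pow_succ]
    push_cast
    field_simp
    linear_combination -2 * step

theorem hasSum_centralBinom {x : ℝ} (hx : |x| < 1) :
    HasSum (fun n : ℕ => (n.centralBinom : ℝ) / 4 ^ n * x ^ n) (1 / √(1 - x)) := by
  have h := (Real.one_div_one_sub_rpow_hasFPowerSeriesOnBall_zero (1 / 2)).hasSum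
    (y := x) (by simpa [enorm_eq_nnnorm] using! hx)
  simpa [← Ring.multichoose_eq, ← one_div, multichoose_half_eq, Real.sqrt_eq_rpow, mul_comm] using h

section Diagonal

variable {ι : Type*} {k : ℕ}

/-- The word in which each letter of `u` is doubled. These are the words at which the tensor power
of a diagonal matrix does not vanish. -/
def double (u : Fin k → ι) (p : Fin k × Fin 2) : ι := u p.1

theorem content_double [DecidableEq ι] (u : Fin k → ι) (i : ι) :
    content (double u) i = 2 * content u i := by
  have e : {p : Fin k × Fin 2 // double u p = i} ≃ {j : Fin k // u j = i} × Fin 2 :=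
    { toFun := fun p => (⟨p.1.1, p.2⟩, p.1.2)
      invFun := fun q => ⟨(q.1.1, q.2), q.1.2⟩ }
  rw [content, Fintype.card_congr e, Fintype.card_prod, Fintype.card_fin, mul_comm, content]

variable [DecidableEq ι]

theorem content_double_eq_iff (u u' : Fin k → ι) :
    content (double u') = content (double u) ↔ content u' = content u := by
  simp [funext_iff, content_double]

theorem pairProd_diagonal_double (d : ι → ℝ) (u : Fin k → ι) :
    pairProd (Matrix.diagonal d) (double u) = ∏ j, d (u j) := by
  simp [pairProd, double]

theorem exists_eq_double_of_pairProd_diagonal_ne_zero {d : ι → ℝ} {w : Fin k × Fin 2 → ι}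
    (h : pairProd (Matrix.diagonal d) w ≠ 0) : ∃ u : Fin k → ι, double u = w := by
  have letters_eq (j : Fin k) : w (j, 0) = w (j, 1) := by
    by_contra hj
    exact prod_ne_zero_iff.mp h j (mem_univ j) (Matrix.diagonal_apply_ne d hj)
  refine ⟨fun j => w (j, 0), funext fun ⟨j, b⟩ => ?_⟩
  fin_cases b
  · rfl
  · exact letters_eq j

variable [Fintype ι]

theorem sum_mul_pairProd_diagonal (d : ι → ℝ) (g : (Fin k × Fin 2 → ι) → ℝ) :
    ∑ w, g w * pairProd (Matrix.diagonal d) w =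
      ∑ u : Fin k → ι, g (double u) * ∏ j, d (u j) := by
  have double_injective : Function.Injective (double : (Fin k → ι) → Fin k × Fin 2 → ι) :=
    fun u v h => funext fun j => congrFun h (j, 0)
  refine (sum_of_injOn double double_injective.injOn (by simp) (fun w _ hw => ?_)
    fun u _ => by rw [pairProd_diagonal_double]).symm
  by_contra hne
  obtain ⟨u, rfl⟩ := exists_eq_double_of_pairProd_diagonal_ne_zero (right_ne_zero_of_mul hne)
  exact hw ⟨u, by simp, rfl⟩

theorem sum_pairProd_diagonal_content_eq (d : ι → ℝ) (u : Fin k → ι) :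
    ∑ w : Fin k × Fin 2 → ι with content w = content (double u),
      pairProd (Matrix.diagonal d) w =
      #{v : Fin k → ι | content v = content u} * ∏ j, d (u j) := by
  have h := sum_mul_pairProd_diagonal d fun w : Fin k × Fin 2 → ι =>
    if content w = content (double u) then 1 else 0
  simp only [ite_mul, one_mul, zero_mul, content_double_eq_iff, ← sum_filter] at h
  rw [h, ← nsmul_eq_mul, ← sum_const]
  refine sum_congr rfl fun v hv => ?_
  rw [prod_comp_eq_prod_pow_content, prod_comp_eq_prod_pow_content u, (mem_filter.mp hv).2]

theorem wordHaf_diagonal_double (d : ι → ℝ) (u : Fin k → ι) :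
    wordHaf (Matrix.diagonal d) (double u) =
      (∏ i, ((2 * content u i)! : ℝ) / (content u i)!) / 2 ^ k * ∏ j, d (u j) := by
  have card_eq : (∏ i, ((content u i)! : ℝ)) * #{v : Fin k → ι | content v = content u} = k ! := by
    exact_mod_cast Fintype.card_fin k ▸ prod_factorial_mul_card_content u
  have factorials_ne_zero : (∏ i, ((content u i)! : ℝ)) ≠ 0 :=
    prod_ne_zero_iff.mpr fun i _ => by positivity
  rw [wordHaf, sum_comp_perm, sum_pairProd_diagonal_content_eq, ← card_eq, prod_div_distrib]
  have card_ne_zero : (#{v : Fin k → ι | content v = content u} : ℝ) ≠ 0 := by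
    rintro h
    rw [h, mul_zero] at card_eq
    exact absurd card_eq.symm (by positivity)
  simp only [content_double, nsmul_eq_mul, Nat.cast_prod]
  field_simp

theorem sum_wordHaf_diagonal_sq (d : ι → ℝ) :
    ∑ w : Fin k × Fin 2 → ι, wordHaf (Matrix.diagonal d) w ^ 2 =
      (2 * k)! / k ! * ∑ u : Fin k → ι,
        ∏ i, (d i ^ 2 / 4) ^ content u i * ((2 * content u i)! / (content u i)!) := by
  rw [sum_wordHaf_sq_eq_sum_mul_pairProd, sum_mul_pairProd_diagonal, mul_sum, mul_sum]
  refine sum_congr rfl fun u _ => ?_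
  have prod_sq : ∏ i, (d i ^ 2 / 4) ^ content u i = (∏ j, d (u j)) ^ 2 / (2 ^ k * 2 ^ k) := by
    rw [← prod_comp_eq_prod_pow_content u fun i => d i ^ 2 / 4, prod_div_distrib, prod_pow,
      prod_const, card_univ, Fintype.card_fin, ← mul_pow]
    norm_num
  rw [wordHaf_diagonal_double, prod_mul_distrib, prod_sq]
  field_simp

theorem sum_wordHaf_diagonal_sq_le {d : ι → ℝ} (hd : ∀ i, |d i| < 1) :
    ∑ w : Fin k × Fin 2 → ι, wordHaf (Matrix.diagonal d) w ^ 2 ≤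
      (2 * k)! * ∏ i, 1 / √(1 - d i ^ 2) := by
  have factor_le (i : ι) :
      ∑ m ∈ range (k + 1), (d i ^ 2 / 4) ^ m * ((2 * m)! / m !) / (m ! : ℝ) ≤
        1 / √(1 - d i ^ 2) := by
    have sq_lt_one : |d i ^ 2| < 1 := by
      rw [abs_sq]
      exact (sq_lt_one_iff_abs_lt_one _).mpr (hd i)
    refine le_of_eq_of_le (sum_congr rfl fun m _ => ?_)
      (sum_le_hasSum (range (k + 1)) (fun m _ => by positivity) (hasSum_centralBinom sq_lt_one))
    rw [centralBinom_eq_factorial_div, div_pow]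
    field_simp
  have words_le := sum_prod_content_le (α := Fin k)
    (f := fun i m => (d i ^ 2 / 4) ^ m * ((2 * m)! / m !)) fun i m => by positivity
  rw [Fintype.card_fin] at words_le
  rw [sum_wordHaf_diagonal_sq]
  calc _ ≤ ((2 * k)! / k ! : ℝ) * (k ! * ∏ i, 1 / √(1 - d i ^ 2)) := by
        refine mul_le_mul_of_nonneg_left (words_le.trans ?_) (by positivity)
        gcongr with i
        exact factor_le i
    _ = _ := by field_simp

end Diagonal

section Hermitian

variable {ι : Type*} [Fintype ι] [DecidableEq ι] {B : Matrix ι ι ℝ}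

theorem exists_orthogonal_diagonalization (hB : B.IsHermitian) :
    ∃ O : Matrix ι ι ℝ, O.transpose * O = 1 ∧
      B = O * Matrix.diagonal hB.eigenvalues * O.transpose := by
  refine ⟨hB.eigenvectorUnitary, ?_, ?_⟩
  · simpa [Matrix.star_eq_conjTranspose] using Unitary.coe_star_mul_self hB.eigenvectorUnitary
  · simpa [Unitary.conjStarAlgAut_apply, Matrix.star_eq_conjTranspose, Function.comp_def] using
      hB.spectral_theorem

theorem sum_wordHaf_sq_le (hB : B.IsHermitian) (h : ∀ i, |hB.eigenvalues i| < 1) (k : ℕ) :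
    ∑ w : Fin k × Fin 2 → ι, wordHaf B w ^ 2 ≤
      (2 * k)! * ∏ i, 1 / √(1 - hB.eigenvalues i ^ 2) := by
  obtain ⟨O, hO, hBO⟩ := exists_orthogonal_diagonalization hB
  calc ∑ w : Fin k × Fin 2 → ι, wordHaf B w ^ 2
      = ∑ w : Fin k × Fin 2 → ι, wordHaf (Matrix.diagonal hB.eigenvalues) w ^ 2 := by
        conv_lhs => rw [hBO]
        exact sum_wordHaf_sq_conj hO _
    _ ≤ _ := sum_wordHaf_diagonal_sq_le h

theorem wordHaf_sq_le (hB : B.IsHermitian) (h : ∀ i, |hB.eigenvalues i| < 1) {k : ℕ}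
    (w : Fin k × Fin 2 → ι) :
    wordHaf B w ^ 2 ≤ (∏ i, ((content w i)! : ℝ)) * ∏ i, 1 / √(1 - hB.eigenvalues i ^ 2) := by
  refine le_of_mul_le_mul_left ?_ (by positivity : (0 : ℝ) < (2 * k)!)
  calc ((2 * k)! : ℝ) * wordHaf B w ^ 2
      ≤ (∏ i, ((content w i)! : ℝ)) * ∑ v : Fin k × Fin 2 → ι, wordHaf B v ^ 2 :=
        factorial_mul_wordHaf_sq_le B w
    _ ≤ (∏ i, ((content w i)! : ℝ)) * ((2 * k)! * ∏ i, 1 / √(1 - hB.eigenvalues i ^ 2)) := by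
        gcongr
        exact sum_wordHaf_sq_le hB h k
    _ = _ := mul_left_comm _ _ _

end Hermitian

theorem le_wordHaf {ι : Type*} {B : Matrix ι ι ℝ} {b : ℝ} (hb : 0 ≤ b) (h : ∀ i j, b ≤ B i j)
    {k : ℕ} (w : Fin k × Fin 2 → ι) :
    b ^ k * ((2 * k)! / (2 ^ k * k !)) ≤ wordHaf B w := by
  have pow_le (σ : Perm (Fin k × Fin 2)) : b ^ k ≤ pairProd B (w ∘ σ) :=
    calc b ^ k = ∏ _j : Fin k, b := by simp
      _ ≤ _ := prod_le_prod (fun _ _ => hb) fun j _ => h _ _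
  have card_perm : Fintype.card (Perm (Fin k × Fin 2)) = (2 * k)! := by
    simp [Fintype.card_perm, mul_comm]
  calc b ^ k * ((2 * k)! / (2 ^ k * k !))
      = 1 / ((k ! : ℝ) * 2 ^ k) * ∑ _σ : Perm (Fin k × Fin 2), b ^ k := by
        rw [sum_const, card_univ, card_perm, nsmul_eq_mul]
        field_simp
    _ ≤ _ := by
        rw [wordHaf]
        gcongr with σ
        exact pow_le σ

section MatrixSpace

variable {N : ℕ}

theorem exists_word {I : Fin N → ℕ} {k : ℕ} (hI : ∑ i, I i = 2 * k) :
    ∃ w : Fin k × Fin 2 → Fin N, content w = I ∧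
      ∀ B : Matrix (Fin N) (Fin N) ℝ, hafB B I = wordHaf B w := by
  have e : Fin k × Fin 2 ≃ (Σ i : Fin N, Fin (I i)) :=
    Fintype.equivOfCardEq (by simp [hI, mul_comm])
  refine ⟨Sigma.fst ∘ e, funext fun i => ?_, fun B => hafnian_submatrix_eq_wordHaf B _ e⟩
  rw [content, Fintype.card_congr (e.subtypeEquiv (p := fun p => (Sigma.fst ∘ e) p = i)
    (q := fun x => x.1 = i) fun _ => Iff.rfl), Fintype.card_congr (Equiv.sigmaSubtype i),
    Fintype.card_fin]

theorem hafB_zero (B : Matrix (Fin N) (Fin N) ℝ) : hafB B 0 = 1 := by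
  obtain ⟨w, -, hw⟩ := exists_word (N := N) (I := 0) (k := 0) (by simp)
  simp [hw, wordHaf, pairProd]

theorem eigenvalues_mem_Ioo (B : matrixSpace N) (j : Fin N) :
    (matrixSpace_isHermitian B).eigenvalues j ∈ Set.Ioo (0 : ℝ) 1 :=
  B.2.2.2 ((matrixSpace_isHermitian B).eigenvalues_mem_spectrum_real j)

theorem abs_eigenvalues_lt_one (B : matrixSpace N) (j : Fin N) :
    |(matrixSpace_isHermitian B).eigenvalues j| < 1 := by
  rw [abs_of_pos (eigenvalues_mem_Ioo B j).1]
  exact (eigenvalues_mem_Ioo B j).2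

theorem gbsD_pos (B : matrixSpace N) : 0 < gbsD B :=
  prod_pos fun j _ => Real.sqrt_pos.mpr <|
    sub_pos.mpr <| (sq_lt_one_iff_abs_lt_one _).mpr (abs_eigenvalues_lt_one B j)

theorem hafB_sq_le (B : matrixSpace N) {I : Fin N → ℕ} {k : ℕ} (hI : ∑ i, I i = 2 * k) :
    hafB (B : Matrix (Fin N) (Fin N) ℝ) I ^ 2 ≤ mfact I / gbsD B := by
  obtain ⟨w, rfl, hw⟩ := exists_word hI
  calc hafB B (content w) ^ 2 = wordHaf (B : Matrix (Fin N) (Fin N) ℝ) w ^ 2 := by rw [hw]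
    _ ≤ _ := wordHaf_sq_le (matrixSpace_isHermitian B) (abs_eigenvalues_lt_one B) w
    _ = _ := by simp [mfact, gbsD, div_eq_mul_inv]

theorem bmin_le (B : matrixSpace N) (i j : Fin N) :
    bmin B ≤ (B : Matrix (Fin N) (Fin N) ℝ) i j :=
  ciInf_le (Set.finite_range fun p : Fin N × Fin N =>
    (B : Matrix (Fin N) (Fin N) ℝ) p.1 p.2).bddBelow (i, j)

variable [NeZero N]

theorem le_bmin (B : matrixSpace N) {c : ℝ} (h : ∀ i j, c ≤ (B : Matrix (Fin N) (Fin N) ℝ) i j) :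
    c ≤ bmin B :=
  le_ciInf fun p => h p.1 p.2

theorem bmin_pos (B : matrixSpace N) : 0 < bmin B := by
  obtain ⟨p, hp⟩ := exists_eq_ciInf_of_finite (f := fun p : Fin N × Fin N =>
    (B : Matrix (Fin N) (Fin N) ℝ) p.1 p.2)
  rw [bmin, ← hp]
  exact B.2.1 _ _

theorem le_hafB (B : matrixSpace N) {I : Fin N → ℕ} {k : ℕ} (hI : ∑ i, I i = 2 * k) :
    bmin B ^ k * ((2 * k)! / (2 ^ k * k !)) ≤ hafB (B : Matrix (Fin N) (Fin N) ℝ) I := by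
  obtain ⟨w, -, hw⟩ := exists_word hI
  rw [hw]
  exact le_wordHaf (bmin_pos B).le (bmin_le B) w

theorem hafB_pos (B : matrixSpace N) {I : Fin N → ℕ} {k : ℕ} (hI : ∑ i, I i = 2 * k) :
    0 < hafB (B : Matrix (Fin N) (Fin N) ℝ) I :=
  (mul_pos (pow_pos (bmin_pos B) k) (by positivity)).trans_le (le_hafB B hI)

end MatrixSpace

theorem stirlingSeq_le {s : ℕ} (hs : s ≠ 0) :
    Stirling.stirlingSeq s ≤ √Real.pi * Real.exp (1 / 12) := by
  have le_sqrt_pi : Stirling.stirlingSeq 1 * Real.exp (-(1 / 12)) ≤ √Real.pi := by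
    refine ge_of_tendsto ((tendsto_add_atTop_iff_nat 1).mpr Stirling.tendsto_stirlingSeq_sqrt_pi)
      (.of_forall fun n => ?_)
    have first_pos : 0 < Stirling.stirlingSeq 1 := Stirling.stirlingSeq'_pos 0
    rw [← Real.log_le_log_iff (by positivity) (Stirling.stirlingSeq'_pos n),
      Real.log_mul first_pos.ne' (Real.exp_ne_zero _), Real.log_exp]
    linarith [Stirling.log_stirlingSeq_bounded_aux n]
  obtain ⟨n, rfl⟩ := Nat.exists_eq_succ_of_ne_zero hs
  calc Stirling.stirlingSeq (n + 1) ≤ Stirling.stirlingSeq 1 :=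
        Stirling.stirlingSeq'_antitone (Nat.zero_le n)
    _ = Stirling.stirlingSeq 1 * Real.exp (-(1 / 12)) * Real.exp (1 / 12) := by
        rw [mul_assoc, ← Real.exp_add, neg_add_cancel, Real.exp_zero, mul_one]
    _ ≤ _ := by gcongr

theorem factorial_le_stirling {s : ℕ} (hs : s ≠ 0) :
    (s ! : ℝ) ≤ √(2 * Real.pi * s) * (s / Real.exp 1) ^ s * Real.exp (1 / 12) := by
  have h := stirlingSeq_le hs
  have s_pos : (0 : ℝ) < s := by positivity
  rw [Stirling.stirlingSeq, div_le_iff₀ (by positivity)] at h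
  refine h.trans_eq ?_
  rw [mul_comm 2 Real.pi, mul_assoc Real.pi, Real.sqrt_mul Real.pi_pos.le]
  ring

theorem mul_exp_div_add_le {x r : ℝ} (hx : 0 ≤ x) (hr : 0 ≤ r) :
    x * Real.exp (r / (x + r)) ≤ x + r := by
  rcases (add_nonneg hx hr).eq_or_lt with h | h
  · simp [(by linarith : x = 0), hr]
  · have := Real.add_one_le_exp (-(r / (x + r)))
    calc x * Real.exp (r / (x + r))
        = (x + r) * (-(r / (x + r)) + 1) * Real.exp (r / (x + r)) := by field_simp; ring
      _ ≤ (x + r) * Real.exp (-(r / (x + r))) * Real.exp (r / (x + r)) := by gcongr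
      _ = x + r := by rw [mul_assoc, ← Real.exp_add, neg_add_cancel, Real.exp_zero, mul_one]

theorem sqrt_mul_mul_exp_div_add_le_factorial_add (x r : ℕ) :
    √(2 * Real.pi * x) * ((x : ℝ) ^ (x + r) * Real.exp (-x)) ≤ (x + r)! := by
  refine le_trans ?_ (Stirling.le_factorial_stirling (x + r))
  have exponent_eq : ((x + r : ℕ) : ℝ) * (r / (x + r)) - (x + r : ℕ) * 1 = -x := by
    rcases (x + r).eq_zero_or_pos with h | h
    · obtain ⟨rfl, rfl⟩ := Nat.add_eq_zero_iff.mp h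
      simp
    · have : (x : ℝ) + r ≠ 0 := by exact_mod_cast h.ne'
      push_cast
      field_simp
      ring
  calc √(2 * Real.pi * x) * ((x : ℝ) ^ (x + r) * Real.exp (-x))
      = √(2 * Real.pi * x) * ((x * Real.exp (r / (x + r))) ^ (x + r) / Real.exp 1 ^ (x + r)) := by
        rw [mul_pow, ← Real.exp_nat_mul, ← Real.exp_nat_mul, mul_div_assoc, ← Real.exp_sub,
          exponent_eq]
    _ ≤ √(2 * Real.pi * (x + r : ℕ)) * (((x : ℝ) + r) ^ (x + r) / Real.exp 1 ^ (x + r)) := by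
        gcongr
        · lia
        · exact mul_exp_div_add_le x.cast_nonneg r.cast_nonneg
    _ = _ := by rw [div_pow, Nat.cast_add]

theorem rpow_sub_one_div_two {x : ℝ} (hx : 0 < x) (n : ℕ) :
    x ^ (((n : ℝ) - 1) / 2) = √x ^ n / √x := by
  rw [Real.sqrt_eq_rpow, ← Real.rpow_natCast, ← Real.rpow_mul hx.le, ← Real.rpow_sub hx]
  ring_nf

theorem factorial_pow_mul_pow_div_factorial_le {N s : ℕ} (hN : N ≠ 0) (hs : s ≠ 0) (r : ℕ) :
    (s ! : ℝ) ^ N * ((s : ℝ) + 1) ^ r / (N * s + r)! ≤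
      (2 * Real.pi * s) ^ (((N : ℝ) - 1) / 2) / √N * Real.exp ((N : ℝ) / 12) *
        (2 / (N : ℝ)) ^ r * (1 / (N : ℝ) ^ N) ^ s := by
  have one_le_s : (1 : ℝ) ≤ s := Nat.one_le_cast.mpr (Nat.one_le_iff_ne_zero.mpr hs)
  have numerator_le : (s ! : ℝ) ^ N ≤ √(2 * Real.pi * s) ^ N *
      ((s : ℝ) ^ (N * s) * Real.exp (-((N * s : ℕ) : ℝ))) * Real.exp ((N : ℝ) / 12) := by
    refine (pow_le_pow_left₀ (by positivity) (factorial_le_stirling hs) N).trans_eq ?_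
    rw [mul_pow, mul_pow, ← pow_mul, ← Real.exp_nat_mul, mul_comm s N, div_pow, Real.exp_neg,
      Real.exp_one_pow, mul_one_div, div_eq_mul_inv (_ ^ _)]
  have base_le : ((s : ℝ) + 1) ^ r ≤ (2 * s) ^ r := by
    gcongr
    linarith
  have denominator_ge := sqrt_mul_mul_exp_div_add_le_factorial_add (N * s) r
  have sqrt_split : √(2 * Real.pi * (N * s : ℕ)) = √(2 * Real.pi * s) * √N := by
    rw [← Real.sqrt_mul (by positivity)]
    push_cast
    ring_nf
  refine (div_le_div₀ (by positivity) (mul_le_mul numerator_le base_le (by positivity)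
    (by positivity)) (by positivity) denominator_ge).trans_eq ?_
  rw [rpow_sub_one_div_two (by positivity), sqrt_split]
  push_cast
  rw [mul_pow (N : ℝ) (s : ℝ), pow_add, pow_add, mul_pow, div_pow, div_pow, one_pow, ← pow_mul]
  field_simp

theorem rpow_le_of_half_le {q k x : ℝ} (hx : 0 < x) (half_le : x / 2 ≤ k) (hk : k ≤ x) :
    k ^ q ≤ 2 ^ (-min q 0) * x ^ q := by
  rcases le_total 0 q with hq | hq
  · rw [min_eq_right hq]
    simpa using Real.rpow_le_rpow (by linarith) hk hq
  · rw [min_eq_left hq, Real.rpow_neg zero_le_two, ← div_eq_inv_mul,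
      ← Real.div_rpow hx.le zero_le_two]
    exact Real.rpow_le_rpow_of_nonpos (by linarith) half_le hq

section Polylog

variable (s : ℝ) {K : ℕ∞} {z : ℝ}

theorem polylog_eq_tsum_indicator (K : ℕ∞) (z : ℝ) :
    polylog s K z = ∑' k, Set.indicator {k : ℕ | 1 ≤ k ∧ (k : ℕ∞) ≤ K}
      (fun k : ℕ => z ^ k / (k : ℝ) ^ s) k := by
  simp only [polylog, Set.indicator, Set.mem_ofPred_eq]

theorem summable_polylog (hz : 0 ≤ z) (h : K = ⊤ → z < 1) :
    Summable (Set.indicator {k : ℕ | 1 ≤ k ∧ (k : ℕ∞) ≤ K}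
      fun k : ℕ => z ^ k / (k : ℝ) ^ s) := by
  by_cases hK : K = ⊤
  · obtain ⟨n, hn⟩ := exists_nat_ge (-s)
    have majorant := summable_pow_mul_geometric_of_norm_lt_one (R := ℝ) n (r := z)
      (by rw [Real.norm_of_nonneg hz]; exact h hK)
    refine majorant.of_nonneg_of_le (Set.indicator_nonneg fun k _ => by positivity)
      (Set.indicator_le' (fun k hk => ?_) fun k _ => by positivity)
    rw [div_eq_mul_inv, ← Real.rpow_neg k.cast_nonneg, mul_comm, ← Real.rpow_natCast (k : ℝ)]
    gcongr
    exact_mod_cast hk.1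
  · lift K to ℕ using hK
    refine summable_of_ne_finset_zero (s := range (K + 1)) fun k hk =>
      Set.indicator_of_notMem (fun hkK => hk (mem_range.mpr ?_)) _
    exact Nat.lt_succ_iff.mpr (by exact_mod_cast hkK.2)

theorem sum_le_polylog (hz : 0 ≤ z) (h : K = ⊤ → z < 1) {F : Finset ℕ}
    (hF : ∀ k ∈ F, 1 ≤ k ∧ (k : ℕ∞) ≤ K) : ∑ k ∈ F, z ^ k / (k : ℝ) ^ s ≤ polylog s K z := by
  rw [polylog_eq_tsum_indicator]
  refine le_of_eq_of_le (sum_congr rfl fun k hk => ?_) ((summable_polylog s hz h).sum_le_tsum F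
    fun k _ => Set.indicator_nonneg (fun k _ => by positivity) k)
  rw [Set.indicator_of_mem (by exact hF k hk)]

theorem polylog_nonneg (hz : 0 ≤ z) : 0 ≤ polylog s K z := by
  rw [polylog_eq_tsum_indicator]
  exact tsum_nonneg (Set.indicator_nonneg fun k _ => by positivity)

theorem polylog_le_of_forall_sum_le (hz : 0 ≤ z) {c : ℝ}
    (h : ∀ M : ℕ, (M : ℕ∞) ≤ K → ∑ k ∈ Icc 1 M, z ^ k / (k : ℝ) ^ s ≤ c) :
    polylog s K z ≤ c := by
  classical
  rw [polylog_eq_tsum_indicator]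
  refine Real.tsum_le_of_sum_le (Set.indicator_nonneg fun k _ => by positivity) fun F => ?_
  rw [sum_indicator_eq_sum_filter]
  set F' := F.filter fun k => k ∈ {k : ℕ | 1 ≤ k ∧ (k : ℕ∞) ≤ K}
  rcases F'.eq_empty_or_nonempty with hF' | hF'
  · simpa [hF'] using h 0 bot_le
  · refine (sum_le_sum_of_subset_of_nonneg (fun k hk => mem_Icc.mpr ?_)
      fun k _ _ => by positivity).trans (h (F'.max' hF') (mem_filter.mp (F'.max'_mem hF')).2.2)
    exact ⟨(mem_filter.mp hk).2.1, F'.le_max' k hk⟩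

end Polylog

theorem one_le_sNum_iff {N k : ℕ} (hN : 1 ≤ N) : 1 ≤ sNum N k ↔ N < 2 * k := by
  rw [sNum, Nat.le_div_iff_mul_le hN]
  lia

theorem mNum_eq_one {N k : ℕ} (hN : 1 ≤ N) (h : 2 * k ≤ N) : mNum N k = 1 := by
  have sNum_eq_zero : sNum N k = 0 := by
    have := (one_le_sNum_iff (k := k) hN).not.mpr (by lia)
    lia
  simp [mNum, sNum_eq_zero]

theorem sNum_le_sENat (N : ℕ) {k : ℕ} {K : ℕ∞} (hk : (k : ℕ∞) ≤ K) :
    (sNum N k : ℕ∞) ≤ sENat N K := by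
  rw [sENat]
  split_ifs with h
  · exact le_top
  · lift K to ℕ using h
    have : k ≤ K := by exact_mod_cast hk
    rw [ENat.toNat_natCast, Nat.cast_le]
    exact Nat.div_le_div_right (by lia)

theorem sENat_eq_top_iff {N : ℕ} {K : ℕ∞} : sENat N K = ⊤ ↔ K = ⊤ := by
  simp [sENat]

section GFun

variable {N : ℕ} (hN : 1 ≤ N) (q : ℝ) {z : ℝ} (hz : 0 ≤ z)

include hN

include hz in
theorem mNum_term_le {k : ℕ} (hk : N < 2 * k) :
    (k : ℝ) ^ q * mNum N k / (2 * k)! * z ^ (2 * k) ≤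
      (2 : ℝ) ^ (((N : ℝ) - 1) / 2 - min q 0) * Real.pi ^ (((N : ℝ) - 1) / 2) *
      (N : ℝ) ^ (q - 1 / 2) * Real.exp ((N : ℝ) / 12) *
      ((2 * z / N) ^ rNum N k / (rNum N k : ℝ) ^ (0 : ℝ) *
        ((z ^ N / (N : ℝ) ^ N) ^ sNum N k / (sNum N k : ℝ) ^ (1 / 2 - (N : ℝ) / 2 - q))) := by
  obtain ⟨two_mul_k, -, r_le⟩ := sNum_rNum_spec hN (by lia : 1 ≤ k)
  have one_le_s := (one_le_sNum_iff hN).mpr hk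
  rw [mNum]
  set s := sNum N k
  set r := rNum N k
  have s_pos : (0 : ℝ) < s := by exact_mod_cast one_le_s
  have N_pos : (0 : ℝ) < N := by exact_mod_cast hN
  have two_mul_k_cast : (2 : ℝ) * k = N * s + r := by exact_mod_cast two_mul_k
  have r_le_mul : (r : ℝ) ≤ N * s := by
    exact_mod_cast r_le.trans (Nat.le_mul_of_pos_right N one_le_s)
  have k_rpow_le : (k : ℝ) ^ q ≤ 2 ^ (-min q 0) * (N * s) ^ q :=
    rpow_le_of_half_le (by positivity) (by linarith [r.cast_nonneg (α := ℝ)]) (by linarith)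
  rw [two_mul_k]
  have factorial_ratio_le := factorial_pow_mul_pow_div_factorial_le (N := N) (s := s) (by lia)
    (by lia) r
  calc _ = (k : ℝ) ^ q * ((s ! : ℝ) ^ N * ((s : ℝ) + 1) ^ r / (N * s + r)!) *
          z ^ (N * s + r) := by ring
    _ ≤ (2 ^ (-min q 0) * (N * s) ^ q) * ((2 * Real.pi * s) ^ (((N : ℝ) - 1) / 2) / √N *
          Real.exp ((N : ℝ) / 12) * (2 / (N : ℝ)) ^ r * (1 / (N : ℝ) ^ N) ^ s) *
          z ^ (N * s + r) := by gcongr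
    _ = _ := by
      have exponent_eq : (1 : ℝ) / 2 - (N : ℝ) / 2 - q = -(((N : ℝ) - 1) / 2 + q) := by ring
      rw [exponent_eq, Real.rpow_neg s_pos.le, Real.rpow_add s_pos, sub_eq_add_neg _ (min q 0),
        Real.rpow_add zero_lt_two, Real.rpow_sub N_pos, ← Real.sqrt_eq_rpow,
        Real.mul_rpow N_pos.le s_pos.le, Real.mul_rpow (by positivity) s_pos.le,
        Real.mul_rpow zero_le_two Real.pi_pos.le, Real.rpow_zero, pow_add z, pow_mul z,
        mul_div_right_comm (2 : ℝ) z, mul_pow _ z]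
      simp only [mul_pow, inv_pow, div_eq_mul_inv, inv_inv, inv_one, mul_one, one_mul, mul_inv]
      ring

theorem sum_rNum_mul_sNum_le {f g : ℕ → ℝ} (hf : ∀ r, 0 ≤ f r) (hg : ∀ s, 0 ≤ g s)
    {F : Finset ℕ} (hF : ∀ k ∈ F, 1 ≤ k) :
    ∑ k ∈ F, f (rNum N k) * g (sNum N k) ≤
      (∑ r ∈ F.image (rNum N), f r) * ∑ s ∈ F.image (sNum N), g s := by
  have pair_injOn : Set.InjOn (fun k => (rNum N k, sNum N k)) F := fun k hk l hl hkl => by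
    have k_eq := (sNum_rNum_spec hN (hF k hk)).1
    have l_eq := (sNum_rNum_spec hN (hF l hl)).1
    rw [Prod.mk.injEq] at hkl
    rw [hkl.1, hkl.2] at k_eq
    lia
  rw [sum_mul_sum, ← sum_product', ← sum_image (f := fun p : ℕ × ℕ => f p.1 * g p.2) pair_injOn]
  refine sum_le_sum_of_subset_of_nonneg (fun p hp => ?_) fun p _ _ => mul_nonneg (hf _) (hg _)
  obtain ⟨k, hk, rfl⟩ := mem_image.mp hp
  exact mem_product.mpr ⟨mem_image_of_mem _ hk, mem_image_of_mem _ hk⟩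

include hz

theorem sum_low_degree_le_hFun {F : Finset ℕ} (hF : ∀ k ∈ F, 1 ≤ k ∧ 2 * k ≤ N) :
    ∑ k ∈ F, (k : ℝ) ^ q * mNum N k / (2 * k)! * z ^ (2 * k) ≤ hFun q (N / 2) z := by
  refine le_of_eq_of_le (sum_congr rfl fun k hk => ?_) (sum_le_sum_of_subset_of_nonneg
    (fun k hk => mem_Icc.mpr ⟨(hF k hk).1, ?_⟩) fun k _ _ => by positivity)
  · rw [mNum_eq_one hN (hF k hk).2, mul_one]
  · have := (hF k hk).2
    lia

variable {K : ℕ∞} (h : K = ⊤ → z < N)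

include h

theorem sum_high_degree_le {F : Finset ℕ} (hF : ∀ k ∈ F, (k : ℕ∞) ≤ K ∧ N < 2 * k) :
    ∑ k ∈ F, (2 * z / N) ^ rNum N k / (rNum N k : ℝ) ^ (0 : ℝ) *
        ((z ^ N / (N : ℝ) ^ N) ^ sNum N k / (sNum N k : ℝ) ^ (1 / 2 - (N : ℝ) / 2 - q)) ≤
      polylog 0 (N : ℕ∞) (2 * z / N) *
        polylog (1 / 2 - (N : ℝ) / 2 - q) (sENat N K) (z ^ N / (N : ℝ) ^ N) := by
  have N_pos : (0 : ℝ) < N := by exact_mod_cast hN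
  have one_le : ∀ k ∈ F, 1 ≤ k := fun k hk => by have := (hF k hk).2; lia
  have rNum_sum_le : ∑ r ∈ F.image (rNum N), (2 * z / N) ^ r / (r : ℝ) ^ (0 : ℝ) ≤
      polylog 0 (N : ℕ∞) (2 * z / N) := by
    refine sum_le_polylog 0 (by positivity) (by simp) (forall_mem_image.mpr fun k hk => ?_)
    exact_mod_cast (sNum_rNum_spec hN (one_le k hk)).2
  have sNum_sum_le : ∑ s ∈ F.image (sNum N),
      (z ^ N / (N : ℝ) ^ N) ^ s / (s : ℝ) ^ (1 / 2 - (N : ℝ) / 2 - q) ≤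
      polylog (1 / 2 - (N : ℝ) / 2 - q) (sENat N K) (z ^ N / (N : ℝ) ^ N) := by
    refine sum_le_polylog _ (by positivity) (fun h_top => ?_) (forall_mem_image.mpr fun k hk => ?_)
    · rw [← div_pow]
      exact pow_lt_one₀ (by positivity) ((div_lt_one N_pos).mpr (h (sENat_eq_top_iff.mp h_top)))
        (by lia)
    · exact ⟨(one_le_sNum_iff hN).mpr (hF k hk).2, sNum_le_sENat N (hF k hk).1⟩
  refine (sum_rNum_mul_sNum_le hN (f := fun r : ℕ => (2 * z / N) ^ r / (r : ℝ) ^ (0 : ℝ))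
    (g := fun s : ℕ => (z ^ N / (N : ℝ) ^ N) ^ s / (s : ℝ) ^ (1 / 2 - (N : ℝ) / 2 - q))
    (fun r => by positivity) (fun s => by positivity) one_le).trans ?_
  exact mul_le_mul rNum_sum_le sNum_sum_le (sum_nonneg fun s _ => by positivity)
    (polylog_nonneg _ (by positivity))

theorem sum_le_gFun {F : Finset ℕ} (hF : ∀ k ∈ F, 1 ≤ k ∧ (k : ℕ∞) ≤ K) :
    ∑ k ∈ F, (k : ℝ) ^ q * mNum N k / (2 * k)! * z ^ (2 * k) ≤ gFun q K N z := by
  rw [← sum_filter_add_sum_filter_not F (fun k => 2 * k ≤ N), gFun]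
  refine add_le_add (sum_low_degree_le_hFun hN q hz fun k hk => ?_) ?_
  · exact ⟨(hF k (mem_filter.mp hk).1).1, (mem_filter.mp hk).2⟩
  have high_degree : ∀ k ∈ F.filter fun k => ¬ 2 * k ≤ N, (k : ℕ∞) ≤ K ∧ N < 2 * k := fun k hk =>
    ⟨(hF k (mem_filter.mp hk).1).2, not_le.mp (mem_filter.mp hk).2⟩
  refine (sum_le_sum fun k hk => mNum_term_le hN q hz (high_degree k hk).2).trans ?_
  rw [← mul_sum, mul_assoc _ (polylog _ _ _)]
  exact mul_le_mul_of_nonneg_left (sum_high_degree_le hN q hz h high_degree) (by positivity)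

end GFun

section Coeff

variable {N : ℕ} {K : ℕ∞}

theorem mem_level {k : ℕ} {I : Fin N → ℕ} : I ∈ level N k ↔ ∑ i, I i = 2 * k := by
  simp [level]

theorem level_zero : level N 0 = {0} := by
  simp [level]

theorem pairwise_disjoint_level : Pairwise (Function.onFun Disjoint (level N)) :=
  fun k l hkl => disjoint_left.mpr fun I hk hl => hkl <| by
    rw [mem_level] at hk hl
    lia

theorem mfact_zero : mfact (0 : Fin N → ℕ) = 1 := by
  simp [mfact]

theorem mfact_pos (I : Fin N → ℕ) : 0 < mfact I :=
  prod_pos fun i _ => by positivity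

theorem coeff_nonneg (a : CoeffSpace N K) (I : Fin N → ℕ) : 0 ≤ coeff a I := by
  rw [coeff]
  split_ifs
  · exact NNReal.coe_nonneg _
  · exact le_rfl

theorem exists_of_coeff_ne_zero {a : CoeffSpace N K} {I : Fin N → ℕ} (h : coeff a I ≠ 0) :
    ∃ k : ℕ, (k : ℕ∞) ≤ K ∧ ∑ i, I i = 2 * k := by
  by_contra hn
  exact h (dif_neg hn)

theorem coeff_mul_le_coeff_mul (a : CoeffSpace N K) {I : Fin N → ℕ} {x y : ℝ}
    (h : ∀ k : ℕ, ∑ i, I i = 2 * k → x ≤ y) : coeff a I * x ≤ coeff a I * y := by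
  by_cases hI : coeff a I = 0
  · simp [hI]
  · obtain ⟨k, -, hk⟩ := exists_of_coeff_ne_zero hI
    exact mul_le_mul_of_nonneg_left (h k hk) (coeff_nonneg a I)

theorem coeff_mul_nonneg (a : CoeffSpace N K) {I : Fin N → ℕ} {x : ℝ}
    (h : ∀ k : ℕ, ∑ i, I i = 2 * k → 0 ≤ x) : 0 ≤ coeff a I * x := by
  simpa using coeff_mul_le_coeff_mul a h

theorem sum_le_of_level_sums_le {f : (Fin N → ℕ) → ℝ} (hf : ∀ I, 0 ≤ f I)
    (hsupp : ∀ I, f I ≠ 0 → ∃ k : ℕ, (k : ℕ∞) ≤ K ∧ ∑ i, I i = 2 * k) {c : ℝ}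
    (h : ∀ M : ℕ, (M : ℕ∞) ≤ K → ∑ k ∈ range (M + 1), ∑ I ∈ level N k, f I ≤ c)
    (s : Finset (Fin N → ℕ)) : ∑ I ∈ s, f I ≤ c := by
  classical
  obtain ⟨M, hMK, hM⟩ :
      ∃ M : ℕ, (M : ℕ∞) ≤ K ∧ ∀ I ∈ s, f I ≠ 0 → ∃ k ≤ M, ∑ i, I i = 2 * k := by
    by_cases hK : K = ⊤
    · refine ⟨s.sup fun I => ∑ i, I i, by simp [hK], fun I hI hfI => ?_⟩
      obtain ⟨k, -, hk⟩ := hsupp I hfI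
      have := le_sup (f := fun I : Fin N → ℕ => ∑ i, I i) hI
      exact ⟨k, by lia, hk⟩
    · lift K to ℕ using hK
      refine ⟨K, le_rfl, fun I _ hfI => ?_⟩
      obtain ⟨k, hk, hI⟩ := hsupp I hfI
      exact ⟨k, by exact_mod_cast hk, hI⟩
  refine le_trans ?_ (h M hMK)
  rw [← sum_biUnion (pairwise_disjoint_level.set_pairwise _), ← sum_filter_ne_zero]
  refine sum_le_sum_of_subset_of_nonneg (fun I hI => ?_) fun I _ _ => hf I
  rw [mem_filter] at hI
  obtain ⟨k, hk, hIk⟩ := hM I hI.1 hI.2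
  exact mem_biUnion.mpr ⟨k, mem_range.mpr (by lia), mem_level.mpr hIk⟩

theorem sum_blocks_le_tsum {f : (Fin N → ℕ) × (Fin N → ℕ) → ℝ} (hf : ∀ p, 0 ≤ f p)
    (hs : Summable f) (F : Finset ℕ) :
    ∑ n ∈ F, ∑ ij ∈ antidiagonal n, ∑ I ∈ level N ij.1, ∑ J ∈ level N ij.2, f (I, J) ≤
      ∑' p, f p := by
  classical
  have block_eq (n : ℕ) :
      ∑ ij ∈ antidiagonal n, ∑ I ∈ level N ij.1, ∑ J ∈ level N ij.2, f (I, J) =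
        ∑ p ∈ (antidiagonal n).biUnion fun ij => level N ij.1 ×ˢ level N ij.2, f p := by
    rw [sum_biUnion fun p _ q _ hpq => ?_]
    · simp only [sum_product]
    · refine disjoint_left.mpr fun x hx hy => hpq ?_
      rw [mem_product, mem_level, mem_level] at hx hy
      ext <;> lia
  simp_rw [block_eq]
  rw [← sum_biUnion fun n _ m _ hnm => ?_]
  · exact hs.sum_le_tsum _ fun p _ => hf p
  · refine disjoint_left.mpr fun x hx hy => hnm ?_
    simp only [mem_biUnion, mem_product, mem_level,
      HasAntidiagonal.mem_antidiagonal] at hx hy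
    obtain ⟨p, hp, hp1, hp2⟩ := hx
    obtain ⟨q, hq, hq1, hq2⟩ := hy
    rw [← hp, ← hq]
    lia

end Coeff

section Bounds

variable {N : ℕ} {K : ℕ∞}

/-- The sum `∑_I a_I I! / Haf(B_I)`, the factor of `Q^{GBS-P}` other than `μ_Haf` and `1/d`. -/
noncomputable def dualSum (B : matrixSpace N) (a : CoeffSpace N K) : ℝ :=
  ∑' I : Fin N → ℕ, coeff a I * mfact I / hafB B.1 I

variable [NeZero N] (B : matrixSpace N) (a : CoeffSpace N K)

theorem muHaf_term_nonneg (I : Fin N → ℕ) : 0 ≤ coeff a I * hafB B.1 I :=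
  coeff_mul_nonneg a fun _ hI => (hafB_pos B hI).le

theorem dualSum_term_nonneg (I : Fin N → ℕ) : 0 ≤ coeff a I * mfact I / hafB B.1 I := by
  rw [mul_div_assoc]
  exact coeff_mul_nonneg a fun _ hI => (div_pos (mfact_pos I) (hafB_pos B hI)).le

theorem qMC_term_nonneg (p : (Fin N → ℕ) × (Fin N → ℕ)) :
    0 ≤ coeff a p.1 * coeff a p.2 * hafB B.1 (p.1 + p.2) := by
  rw [mul_assoc]
  refine coeff_mul_nonneg a fun k hk => coeff_mul_nonneg a fun l hl =>
    (hafB_pos B (k := k + l) ?_).le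
  simp only [Pi.add_apply, sum_add_distrib]
  lia

variable {B a}

theorem coeff_zero_le_muHaf (h : Summable fun I : Fin N → ℕ => coeff a I * hafB B.1 I) :
    coeff a 0 ≤ muHaf B a := by
  simpa [muHaf, hafB_zero] using h.le_tsum 0 fun I _ => muHaf_term_nonneg B a I

theorem level_dualSum_le {γ q : ℝ} (hγ : 0 ≤ γ) {k : ℕ}
    (h : ∑ I ∈ level N k, coeff a I * mfact I ≤ (k : ℝ) ^ q * γ ^ k / k ! * mNum N k) :
    ∑ I ∈ level N k, coeff a I * mfact I / hafB B.1 I ≤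
      (k : ℝ) ^ q * mNum N k / (2 * k)! * √(2 * γ * (bmin B)⁻¹) ^ (2 * k) := by
  have bmin_pos := bmin_pos B
  calc ∑ I ∈ level N k, coeff a I * mfact I / hafB B.1 I
      ≤ ∑ I ∈ level N k, coeff a I * mfact I / (bmin B ^ k * ((2 * k)! / (2 ^ k * k !))) := by
        refine sum_le_sum fun I hI => ?_
        exact div_le_div_of_nonneg_left (mul_nonneg (coeff_nonneg a I) (mfact_pos I).le)
          (by positivity) (le_hafB B (mem_level.mp hI))
    _ ≤ (k : ℝ) ^ q * γ ^ k / k ! * mNum N k / (bmin B ^ k * ((2 * k)! / (2 ^ k * k !))) := by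
        rw [← sum_div]
        gcongr
    _ = _ := by
      rw [pow_mul, Real.sq_sqrt (by positivity), mul_pow, mul_pow, inv_pow]
      field_simp

theorem dualSum_le {γα γβ qα qβ : ℝ} (hγ : 0 ≤ γβ)
    (hz : K = ⊤ → √(2 * γβ * (bmin B)⁻¹) < (N : ℝ)) (h : CoeffBounds γα γβ qα qβ a) :
    dualSum B a ≤ coeff a 0 + gFun qβ K N (√(2 * γβ * (bmin B)⁻¹)) := by
  have hN : 1 ≤ N := Nat.one_le_iff_ne_zero.mpr (NeZero.ne N)
  have supp (I : Fin N → ℕ) (hI : coeff a I * mfact I / hafB B.1 I ≠ 0) :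
      ∃ k : ℕ, (k : ℕ∞) ≤ K ∧ ∑ i, I i = 2 * k :=
    exists_of_coeff_ne_zero (a := a) fun h0 => hI (by simp [h0])
  refine Real.tsum_le_of_sum_le (dualSum_term_nonneg B a)
    (sum_le_of_level_sums_le (dualSum_term_nonneg B a) supp fun M hM => ?_)
  have le_degree : ∀ k ∈ Icc 1 M, 1 ≤ k ∧ (k : ℕ∞) ≤ K := fun k hk =>
    ⟨(mem_Icc.mp hk).1, (Nat.cast_le.mpr (mem_Icc.mp hk).2).trans hM⟩
  rw [sum_range_eq_add_Ico _ M.succ_pos, level_zero, sum_singleton, hafB_zero, mfact_zero, mul_one,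
    div_one, Nat.succ_eq_add_one, Ico_add_one_right_eq_Icc]
  gcongr
  refine (sum_le_sum fun k hk => ?_).trans (sum_le_gFun hN qβ (Real.sqrt_nonneg _) hz le_degree)
  exact level_dualSum_le hγ (h k (le_degree k hk).1 (le_degree k hk).2).2.2

theorem qGBSP_eq (hP : (B, a) ∈ problemSpace N K) :
    qGBSP B a = 1 / gbsD B * (muHaf B a * dualSum B a) := by
  obtain ⟨hμ, -, hdual, -⟩ := hP
  rw [qGBSP, muHaf, dualSum, hμ.tsum_mul_tsum hdual
    (hμ.mul_of_nonneg hdual (muHaf_term_nonneg B a) (dualSum_term_nonneg B a))]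
  congr 1
  exact tsum_congr fun p => by ring

theorem muHaf_le (hP : (B, a) ∈ problemSpace N K) : muHaf B a ≤ 1 / gbsD B * dualSum B a := by
  obtain ⟨hμ, -, hdual, -⟩ := hP
  rw [dualSum, ← tsum_mul_left]
  refine hμ.tsum_le_tsum (fun I => ?_) (hdual.mul_left _)
  calc coeff a I * hafB B.1 I ≤ coeff a I * (mfact I / gbsD B / hafB B.1 I) := by
        refine coeff_mul_le_coeff_mul a fun k hk => ?_
        rw [le_div_iff₀ (hafB_pos B hk), ← sq]
        exact hafB_sq_le B hk
    _ = _ := by ring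

end Bounds

theorem sixteen_pow_le_mul_centralBinom_sq {n : ℕ} (hn : 1 ≤ n) :
    16 ^ n ≤ 4 * n * n.centralBinom ^ 2 := by
  induction n, hn using Nat.le_induction with
  | base => simp [Nat.centralBinom]
  | succ n _ ih =>
    refine Nat.le_of_mul_le_mul_left ?_ n.succ_pos
    calc (n + 1) * 16 ^ (n + 1) = 16 * (n + 1) * 16 ^ n := by ring
      _ ≤ 16 * (n + 1) * (4 * n * n.centralBinom ^ 2) :=
        Nat.mul_le_mul_left _ ih
      _ = 16 * (4 * n * (n + 1)) * n.centralBinom ^ 2 := by ring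
      _ ≤ 16 * (2 * n + 1) ^ 2 * n.centralBinom ^ 2 := by gcongr; nlinarith
      _ = 4 * (2 * (2 * n + 1) * n.centralBinom) ^ 2 := by ring
      _ = 4 * ((n + 1) * (n + 1).centralBinom) ^ 2 := by rw [Nat.succ_mul_centralBinom_succ]
      _ = (n + 1) * (4 * (n + 1) * (n + 1).centralBinom ^ 2) := by ring

theorem four_pow_div_two_mul_sqrt_le_centralBinom {n : ℕ} (hn : 1 ≤ n) :
    (4 : ℝ) ^ n / (2 * √n) ≤ n.centralBinom := by
  have key : (16 : ℝ) ^ n ≤ 4 * n * (n.centralBinom : ℝ) ^ 2 := by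
    exact_mod_cast sixteen_pow_le_mul_centralBinom_sq hn
  rw [div_le_iff₀ (by positivity)]
  refine abs_le_of_sq_le_sq' ?_ (by positivity) |>.2
  calc ((4 : ℝ) ^ n) ^ 2 = 16 ^ n := by rw [← pow_mul, mul_comm, pow_mul]; norm_num
    _ ≤ 4 * n * (n.centralBinom : ℝ) ^ 2 := key
    _ = (n.centralBinom * (2 * √n)) ^ 2 := by
      rw [mul_pow, mul_pow, Real.sq_sqrt n.cast_nonneg]
      ring

/-- A weight `ψ` on degrees with `ψ (i + j) ≤ i ^ q * j ^ q` for all `i, j ≥ 1`; it bounds from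
below the polynomial factors of a product of two level sums of total degree `n = i + j`. -/
noncomputable def convWeight (q : ℝ) (n : ℕ) : ℝ :=
  if 0 ≤ q then ((n : ℝ) / 2) ^ q else (n : ℝ) ^ (2 * q)

theorem convWeight_nonneg (q : ℝ) (n : ℕ) : 0 ≤ convWeight q n := by
  rw [convWeight]
  split_ifs <;> positivity

theorem convWeight_le_rpow (q : ℝ) {n : ℕ} (hn : 1 ≤ n) : convWeight q n ≤ (n : ℝ) ^ q := by
  have one_le_n : (1 : ℝ) ≤ n := by exact_mod_cast hn
  rw [convWeight]
  split_ifs with hq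
  · exact Real.rpow_le_rpow (by positivity) (by linarith) hq
  · exact Real.rpow_le_rpow_of_exponent_le one_le_n (by linarith)

theorem convWeight_add_le_rpow_mul_rpow (q : ℝ) {i j : ℕ} (hi : 1 ≤ i) (hj : 1 ≤ j) :
    convWeight q (i + j) ≤ (i : ℝ) ^ q * (j : ℝ) ^ q := by
  have one_le_i : (1 : ℝ) ≤ i := by exact_mod_cast hi
  have one_le_j : (1 : ℝ) ≤ j := by exact_mod_cast hj
  rw [← Real.mul_rpow (by positivity) (by positivity), convWeight]
  push_cast
  split_ifs with hq
  · exact Real.rpow_le_rpow (by positivity) (by nlinarith) hq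
  · rw [Real.rpow_mul (by positivity), Real.rpow_two]
    exact Real.rpow_le_rpow_of_nonpos (by positivity) (by nlinarith) (by linarith)

theorem sum_antidiagonal_inv_factorial_mul_factorial (n : ℕ) :
    ∑ ij ∈ antidiagonal n, 1 / ((ij.1 ! : ℝ) * ij.2 !) = 2 ^ n / n ! := by
  have sum_choose : ∑ ij ∈ antidiagonal n, (n.choose ij.1 : ℝ) = 2 ^ n := by
    rw [Nat.sum_antidiagonal_eq_sum_range_succ_mk]
    exact_mod_cast Nat.sum_range_choose n
  rw [← sum_choose, sum_div]
  refine sum_congr rfl fun ij hij => ?_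
  obtain rfl := HasAntidiagonal.mem_antidiagonal.mp hij
  rw [Nat.cast_add_choose]
  field_simp

section MonteCarlo

variable {N : ℕ} {K : ℕ∞} {a : CoeffSpace N K} {γ q : ℝ} {n : ℕ}

theorem convWeight_le_level_sum_mul_level_sum (hγ : 0 ≤ γ) (hn : 1 ≤ n)
    (h : ∀ k, 1 ≤ k → k ≤ n → (k : ℝ) ^ q * γ ^ k / k ! ≤ ∑ I ∈ level N k, coeff a I)
    {ij : ℕ × ℕ} (hij : ij ∈ antidiagonal n) :
    min 1 (coeff a 0) * (convWeight q n * γ ^ n) * (1 / (ij.1 ! * ij.2 !)) ≤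
      (∑ I ∈ level N ij.1, coeff a I) * ∑ J ∈ level N ij.2, coeff a J := by
  have level_zero_sum : ∑ I ∈ level N 0, coeff a I = coeff a 0 := by
    rw [level_zero, sum_singleton]
  have weight_nonneg := convWeight_nonneg q n
  have extreme : min 1 (coeff a 0) * (convWeight q n * γ ^ n) * (1 / n !) ≤
      coeff a 0 * ∑ I ∈ level N n, coeff a I := by
    rw [mul_assoc]
    refine mul_le_mul (min_le_right _ _) ((h n hn le_rfl).trans' ?_) (by positivity)
      (coeff_nonneg a 0)
    rw [mul_one_div]
    gcongr
    exact convWeight_le_rpow q hn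
  obtain ⟨i, j⟩ := ij
  obtain rfl : i + j = n := HasAntidiagonal.mem_antidiagonal.mp hij
  rcases Nat.eq_zero_or_pos i with rfl | hi
  · simpa [level_zero_sum] using extreme
  rcases Nat.eq_zero_or_pos j with rfl | hj
  · simpa [level_zero_sum, mul_comm] using extreme
  · calc min 1 (coeff a 0) * (convWeight q (i + j) * γ ^ (i + j)) * (1 / (i ! * j !))
        ≤ 1 * ((i : ℝ) ^ q * (j : ℝ) ^ q * γ ^ (i + j)) * (1 / (i ! * j !)) := by
          gcongr
          · exact min_le_left _ _
          · exact convWeight_add_le_rpow_mul_rpow q hi hj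
      _ = (i : ℝ) ^ q * γ ^ i / i ! * ((j : ℝ) ^ q * γ ^ j / j !) := by
          rw [pow_add]
          field_simp
      _ ≤ _ := mul_le_mul (h i hi (by lia)) (h j hj (by lia)) (by positivity)
          (sum_nonneg fun I _ => coeff_nonneg a I)

variable [NeZero N] {B : matrixSpace N}

theorem level_sum_mul_level_sum_mul_le {ij : ℕ × ℕ} (hij : ij ∈ antidiagonal n) :
    ((∑ I ∈ level N ij.1, coeff a I) * ∑ J ∈ level N ij.2, coeff a J) *
        (bmin B ^ n * ((2 * n)! / (2 ^ n * n !))) ≤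
      ∑ I ∈ level N ij.1, ∑ J ∈ level N ij.2, coeff a I * coeff a J * hafB B.1 (I + J) := by
  rw [sum_mul_sum, sum_mul]
  refine sum_le_sum fun I hI => ?_
  rw [sum_mul]
  refine sum_le_sum fun J hJ => mul_le_mul_of_nonneg_left (le_hafB B ?_)
    (mul_nonneg (coeff_nonneg a I) (coeff_nonneg a J))
  rw [mem_level] at hI hJ
  rw [HasAntidiagonal.mem_antidiagonal] at hij
  simp only [Pi.add_apply, sum_add_distrib]
  lia

theorem convWeight_le_block_sum (hγ : 0 ≤ γ) (hn : 1 ≤ n)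
    (h : ∀ k, 1 ≤ k → k ≤ n → (k : ℝ) ^ q * γ ^ k / k ! ≤ ∑ I ∈ level N k, coeff a I) :
    min 1 (coeff a 0) / 2 * (convWeight q n * ((4 * γ * bmin B) ^ n / √n)) ≤
      ∑ ij ∈ antidiagonal n, ∑ I ∈ level N ij.1, ∑ J ∈ level N ij.2,
        coeff a I * coeff a J * hafB B.1 (I + J) := by
  have bmin_pos := bmin_pos B
  have weight_nonneg := convWeight_nonneg q n
  have min_nonneg : 0 ≤ min 1 (coeff a 0) := le_min zero_le_one (coeff_nonneg a 0)
  calc min 1 (coeff a 0) / 2 * (convWeight q n * ((4 * γ * bmin B) ^ n / √n))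
      = min 1 (coeff a 0) * (convWeight q n * (γ * bmin B) ^ n) * (4 ^ n / (2 * √n)) := by
        rw [mul_assoc 4, mul_pow 4]
        field_simp
    _ ≤ min 1 (coeff a 0) * (convWeight q n * (γ * bmin B) ^ n) * n.centralBinom := by
        gcongr
        exact four_pow_div_two_mul_sqrt_le_centralBinom hn
    _ = min 1 (coeff a 0) * (convWeight q n * γ ^ n) * (2 ^ n / n !) *
          (bmin B ^ n * ((2 * n)! / (2 ^ n * n !))) := by
        rw [centralBinom_eq_factorial_div, mul_pow γ]
        field_simp
    _ = ∑ ij ∈ antidiagonal n, min 1 (coeff a 0) * (convWeight q n * γ ^ n) *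
          (1 / (ij.1 ! * ij.2 !)) * (bmin B ^ n * ((2 * n)! / (2 ^ n * n !))) := by
        rw [← sum_mul, ← mul_sum, sum_antidiagonal_inv_factorial_mul_factorial]
    _ ≤ _ := sum_le_sum fun ij hij => le_trans
        (mul_le_mul_of_nonneg_right (convWeight_le_level_sum_mul_level_sum hγ hn h hij)
          (by positivity)) (level_sum_mul_level_sum_mul_le hij)

theorem rFun_eq_mul_polylog (q : ℝ) (K : ℕ∞) (z : ℝ) :
    ∃ c s : ℝ, 0 < c ∧ rFun q K z = c * polylog s K z ∧
      ∀ n : ℕ, 1 ≤ n → c * (z ^ n / (n : ℝ) ^ s) =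
        1 / (2 * √Real.pi) * (convWeight q n * (z ^ n / √n)) := by
  rw [rFun]
  simp only [convWeight]
  split_ifs with hq
  · refine ⟨2 ^ (-q) * (1 / (2 * √Real.pi)), 1 / 2 - q, by positivity, rfl, fun n hn => ?_⟩
    have n_pos : (0 : ℝ) < n := by exact_mod_cast hn
    rw [Real.rpow_sub n_pos, ← Real.sqrt_eq_rpow, Real.rpow_neg zero_le_two,
      Real.div_rpow n_pos.le zero_le_two]
    field_simp
  · refine ⟨1 / (2 * √Real.pi), 1 / 2 - 2 * q, by positivity, rfl, fun n hn => ?_⟩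
    have n_pos : (0 : ℝ) < n := by exact_mod_cast hn
    rw [Real.rpow_sub n_pos, ← Real.sqrt_eq_rpow]
    field_simp

theorem mul_rFun_le_qMC {γβ qβ : ℝ} (hγ : 0 ≤ γ) (hP : (B, a) ∈ problemSpace N K)
    (h : CoeffBounds γ γβ q qβ a) (ha : 0 < coeff a 0) :
    min 1 (coeff a 0) * √Real.pi * rFun q K (4 * γ * bmin B) ≤ qMC B a := by
  obtain ⟨c, s, c_pos, hR, hterm⟩ := rFun_eq_mul_polylog q K (4 * γ * bmin B)
  have bmin_pos := bmin_pos B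
  rw [hR, ← mul_assoc, ← le_div_iff₀' (by positivity)]
  refine polylog_le_of_forall_sum_le s (by positivity) fun M hM => ?_
  rw [le_div_iff₀' (by positivity), mul_sum]
  refine (sum_le_sum fun n hn => ?_).trans
    (sum_blocks_le_tsum (qMC_term_nonneg B a) hP.2.2.2 (Icc 1 M))
  rw [mem_Icc] at hn
  have lower (k : ℕ) (hk : 1 ≤ k) (hkn : k ≤ n) :=
    (h k hk ((Nat.cast_le.mpr (hkn.trans hn.2)).trans hM)).1
  calc _ = min 1 (coeff a 0) * √Real.pi * (c * ((4 * γ * bmin B) ^ n / (n : ℝ) ^ s)) := by ring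
    _ = min 1 (coeff a 0) / 2 * (convWeight q n * ((4 * γ * bmin B) ^ n / √n)) := by
      rw [hterm n hn.1]
      field_simp
    _ ≤ _ := convWeight_le_block_sum hγ hn.1 lower

end MonteCarlo

section SampleSizes

theorem exp_div_sqrt_pi_le_half : Real.exp (1 / 25 - 1 / 6) / √Real.pi ≤ 1 / 2 := by
  have sqrt_pi_ge : (1.7724 : ℝ) ≤ √Real.pi := by
    refine Real.le_sqrt_of_sq_le ?_
    linarith [Real.pi_gt_d4]
  have exp_ge := Real.quadratic_le_exp_of_nonneg (show (0 : ℝ) ≤ 1 / 6 - 1 / 25 by norm_num)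
  have exp_mul : Real.exp (1 / 25 - 1 / 6) * Real.exp (1 / 6 - 1 / 25) = 1 := by
    rw [← Real.exp_add]
    norm_num
  have exp_pos := Real.exp_pos (1 / 25 - 1 / 6)
  rw [div_le_iff₀ (by positivity)]
  nlinarith

variable {N : ℕ} [NeZero N] {K : ℕ∞} {B : matrixSpace N} {a : CoeffSpace N K}
  {ζ p ε δ γα γβ qα qβ CG CD CR : ℝ}

theorem one_div_gbsD_mul_dualSum_lt (hγβ : 0 ≤ γβ)
    (hB : B ∈ uniformSpace N K ζ p γα γβ qα qβ CG CD CR) (ha : CoeffBounds γα γβ qα qβ a) :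
    1 / gbsD B * dualSum B a < CD * (N : ℝ) ^ p * (coeff a 0 + CG * (N : ℝ) ^ 3) := by
  obtain ⟨domain, gFun_lt, -, gbsD_lt⟩ := hB
  have dualSum_lt := dualSum_le hγβ (fun hK => (domain hK).1) ha
  exact mul_lt_mul'' gbsD_lt (by linarith) (one_div_pos.mpr (gbsD_pos B)).le
    (tsum_nonneg (dualSum_term_nonneg B a))

theorem sub_sq_div_eq {μ : ℝ} (hμ : μ ≠ 0) (Q : ℝ) :
    (Q - μ ^ 2) / (δ * ε ^ 2 * μ ^ 2) = 1 / (ε ^ 2 * δ) * (Q / μ ^ 2 - 1) := by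
  field_simp

theorem rpow_add_three : (N : ℝ) ^ (p + 3) = (N : ℝ) ^ p * (N : ℝ) ^ 3 :=
  mod_cast Real.rpow_add_natCast (NeZero.ne (N : ℝ)) p 3

theorem nGBSP_lt (hε : 0 < ε) (hδ : 0 < δ) (hγβ : 0 ≤ γβ) (hP : (B, a) ∈ problemSpace N K)
    (hB : B ∈ uniformSpace N K ζ p γα γβ qα qβ CG CD CR) (ha : CoeffBounds γα γβ qα qβ a)
    (ha0 : coeff a 0 ≠ 0) :
    nGBSP ε δ B a < 1 / (ε ^ 2 * δ) *
      (CD * (N : ℝ) ^ p + CG * CD * (N : ℝ) ^ (3 + p) / coeff a 0 - 1) := by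
  have a0_pos : 0 < coeff a 0 := (coeff_nonneg a 0).lt_of_ne' ha0
  have a0_le := coeff_zero_le_muHaf hP.1
  have mu_pos : 0 < muHaf B a := a0_pos.trans_le a0_le
  have gbsD_pos := gbsD_pos B
  have dual_nonneg : 0 ≤ dualSum B a := tsum_nonneg (dualSum_term_nonneg B a)
  rw [nGBSP, sub_sq_div_eq mu_pos.ne', qGBSP_eq hP]
  gcongr
  calc 1 / gbsD B * (muHaf B a * dualSum B a) / muHaf B a ^ 2
      = 1 / gbsD B * dualSum B a / muHaf B a := by field_simp
    _ ≤ 1 / gbsD B * dualSum B a / coeff a 0 := by gcongr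
    _ < CD * (N : ℝ) ^ p * (coeff a 0 + CG * (N : ℝ) ^ 3) / coeff a 0 := by
      exact div_lt_div_of_pos_right (one_div_gbsD_mul_dualSum_lt hγβ hB ha) a0_pos
    _ = CD * (N : ℝ) ^ p + CG * CD * (N : ℝ) ^ (3 + p) / coeff a 0 := by
      rw [add_comm 3 p, rpow_add_three]
      field_simp

theorem lt_nMC (hζ : 0 ≤ ζ) (hε : 0 < ε) (hδ : 0 < δ) (hγα : 0 ≤ γα) (hγβ : 0 ≤ γβ)
    (hCR : 0 ≤ CR) (hP : (B, a) ∈ problemSpace N K)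
    (hB : B ∈ uniformSpace N K ζ p γα γβ qα qβ CG CD CR) (ha : CoeffBounds γα γβ qα qβ a)
    (ha0 : coeff a 0 ≠ 0) :
    1 / (ε ^ 2 * δ) *
        (min 1 (coeff a 0) * (Real.exp (1 / 25 - 1 / 6) / √Real.pi) *
            (ζ * (N : ℝ) ^ 2) ^ (2 * qα - 1 / 2) * CR ^ (ζ * (N : ℝ) ^ 2) /
          (CD * (N : ℝ) ^ p * (coeff a 0 + CG * (N : ℝ) ^ 3)) ^ 2 - 1) <
      nMC ε δ B a := by
  have a0_pos : 0 < coeff a 0 := (coeff_nonneg a 0).lt_of_ne' ha0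
  have mu_pos : 0 < muHaf B a := a0_pos.trans_le (coeff_zero_le_muHaf hP.1)
  have mu_lt := (muHaf_le hP).trans_lt (one_div_gbsD_mul_dualSum_lt hγβ hB ha)
  rw [nMC, sub_sq_div_eq mu_pos.ne']
  set X := (ζ * (N : ℝ) ^ 2) ^ (2 * qα - 1 / 2) * CR ^ (ζ * (N : ℝ) ^ 2)
  gcongr 1 / (ε ^ 2 * δ) * (?_ - 1)
  calc _ = min 1 (coeff a 0) * (Real.exp (1 / 25 - 1 / 6) / √Real.pi) * X /
        (CD * (N : ℝ) ^ p * (coeff a 0 + CG * (N : ℝ) ^ 3)) ^ 2 := by simp only [X, mul_assoc]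
    _ ≤ min 1 (coeff a 0) * (1 / 2) * X / muHaf B a ^ 2 := by
      gcongr ?_ * ?_ * X / ?_ ^ 2
      exact exp_div_sqrt_pi_le_half
    _ = min 1 (coeff a 0) * √Real.pi * (1 / (2 * √Real.pi) * X) / muHaf B a ^ 2 := by field_simp
    _ < min 1 (coeff a 0) * √Real.pi * rFun qα K (4 * γα * bmin B) / muHaf B a ^ 2 := by
      gcongr
      simpa only [X, mul_assoc] using hB.2.2.1
    _ ≤ qMC B a / muHaf B a ^ 2 := by
      gcongr
      exact mul_rFun_le_qMC hγα hP ha a0_pos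

variable {l u : ℝ}

theorem nGBSP_le (hε : 0 < ε) (hδ : 0 < δ) (hγβ : 0 ≤ γβ) (hCG : 0 ≤ CG) (hCD : 0 ≤ CD)
    (hP : (B, a) ∈ problemSpace N K) (hB : B ∈ uniformSpace N K ζ p γα γβ qα qβ CG CD CR)
    (ha : CoeffBounds γα γβ qα qβ a) (hl : 0 < l) (hla : l ≤ coeff a 0) :
    nGBSP ε δ B a ≤ 1 / (ε ^ 2 * δ) * ((CD + CG * CD / l) * (N : ℝ) ^ (3 + p)) := by
  refine (nGBSP_lt hε hδ hγβ hP hB ha (hl.trans_le hla).ne').le.trans ?_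
  have one_le_N : (1 : ℝ) ≤ N := by exact_mod_cast NeZero.one_le
  gcongr
  calc CD * (N : ℝ) ^ p + CG * CD * (N : ℝ) ^ (3 + p) / coeff a 0 - 1
      ≤ CD * (N : ℝ) ^ p + CG * CD * (N : ℝ) ^ (3 + p) / coeff a 0 := by linarith
    _ ≤ CD * (N : ℝ) ^ (3 + p) + CG * CD * (N : ℝ) ^ (3 + p) / l := by
      gcongr
      linarith
    _ = (CD + CG * CD / l) * (N : ℝ) ^ (3 + p) := by ring

theorem mul_rpow_mul_add_le (hCD : 0 ≤ CD) {x : ℝ} (hx : 0 ≤ x) (hxu : x ≤ u) :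
    CD * (N : ℝ) ^ p * (x + CG * (N : ℝ) ^ 3) ≤ CD * (u + CG) * (N : ℝ) ^ (p + 3) := by
  have one_le_N : (1 : ℝ) ≤ N := by exact_mod_cast NeZero.one_le
  calc CD * (N : ℝ) ^ p * (x + CG * (N : ℝ) ^ 3)
      ≤ CD * (N : ℝ) ^ p * (u * (N : ℝ) ^ 3 + CG * (N : ℝ) ^ 3) := by
        gcongr
        exact hxu.trans (le_mul_of_one_le_right (hx.trans hxu) (one_le_pow₀ one_le_N))
    _ = CD * (u + CG) * (N : ℝ) ^ (p + 3) := by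
        rw [rpow_add_three]
        ring

theorem rpow_le_nMC {ρ : ℝ} (hζ : 0 ≤ ζ) (hε : 0 < ε) (hδ : 0 < δ) (hγα : 0 ≤ γα) (hγβ : 0 ≤ γβ)
    (hCG : 0 ≤ CG) (hCD : 0 < CD) (hCR : 0 ≤ CR) (hP : (B, a) ∈ problemSpace N K)
    (hB : B ∈ uniformSpace N K ζ p γα γβ qα qβ CG CD CR) (ha : CoeffBounds γα γβ qα qβ a)
    (hl : 0 < l) (hla : l ≤ coeff a 0) (hau : coeff a 0 ≤ u) (hρ : 1 ≤ ρ)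
    (h : 2 * ρ ^ (ζ * (N : ℝ) ^ 2) * (N : ℝ) ^ ((p + 3) * 2) ≤
      min 1 l * (Real.exp (1 / 25 - 1 / 6) / √Real.pi) / (CD * (u + CG)) ^ 2 *
        (ζ * (N : ℝ) ^ 2) ^ (2 * qα - 1 / 2) * CR ^ (ζ * (N : ℝ) ^ 2)) :
    1 / (ε ^ 2 * δ) * ρ ^ (ζ * (N : ℝ) ^ 2) ≤ nMC ε δ B a := by
  have a0_pos : 0 < coeff a 0 := hl.trans_le hla
  have u_pos : 0 < u := a0_pos.trans_le hau
  have N_pos : (0 : ℝ) < N := by exact_mod_cast NeZero.pos N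
  refine le_trans ?_ (lt_nMC hζ hε hδ hγα hγβ hCR hP hB ha a0_pos.ne').le
  gcongr
  rw [le_sub_iff_add_le]
  set E := Real.exp (1 / 25 - 1 / 6) / √Real.pi
  set Y := (ζ * (N : ℝ) ^ 2) ^ (2 * qα - 1 / 2)
  set Z := CR ^ (ζ * (N : ℝ) ^ 2)
  calc ρ ^ (ζ * (N : ℝ) ^ 2) + 1 ≤ 2 * ρ ^ (ζ * (N : ℝ) ^ 2) := by
        linarith [Real.one_le_rpow hρ (show 0 ≤ ζ * (N : ℝ) ^ 2 by positivity)]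
    _ ≤ min 1 l * E / (CD * (u + CG)) ^ 2 * Y * Z / (N : ℝ) ^ ((p + 3) * 2) := by
        rwa [le_div_iff₀ (by positivity)]
    _ = min 1 l * E * Y * Z / (CD * (u + CG) * (N : ℝ) ^ (p + 3)) ^ 2 := by
        rw [Real.rpow_mul N_pos.le, Real.rpow_two]
        field_simp
    _ ≤ min 1 (coeff a 0) * E * Y * Z /
          (CD * (N : ℝ) ^ p * (coeff a 0 + CG * (N : ℝ) ^ 3)) ^ 2 := by
        gcongr min 1 ?_ * E * Y * Z / ?_ ^ 2
        exact mul_rpow_mul_add_le hCD.le a0_pos.le hau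

end SampleSizes

section Growth

theorem tendsto_natCast_sq_atTop : Tendsto (fun N : ℕ => (N : ℝ) ^ 2) atTop atTop :=
  (tendsto_pow_atTop two_ne_zero).comp tendsto_natCast_atTop_atTop

theorem tendsto_log_div_sq : Tendsto (fun N : ℕ => Real.log N / (N : ℝ) ^ 2) atTop (𝓝 0) := by
  have log_div_sq : Tendsto (fun x : ℝ => Real.log x / x ^ 2) atTop (𝓝 0) := by
    simpa using (isLittleO_log_rpow_atTop (r := 2) zero_lt_two).tendsto_div_nhds_zero
  exact log_div_sq.comp tendsto_natCast_atTop_atTop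

theorem eventually_two_mul_rpow_le {ζ κ e CR ρ : ℝ} {qα : ℕ → ℝ} (hζ : 0 < ζ) (hκ : 0 < κ)
    (hq : Dominates ζ qα) (hρ : 0 < ρ) (hρC : ρ < CR) :
    ∀ᶠ N : ℕ in atTop, 2 * ρ ^ (ζ * (N : ℝ) ^ 2) * (N : ℝ) ^ e ≤
      κ * (ζ * (N : ℝ) ^ 2) ^ (2 * qα N - 1 / 2) * CR ^ (ζ * (N : ℝ) ^ 2) := by
  have CR_pos : 0 < CR := hρ.trans hρC
  have gap_pos : 0 < ζ * (Real.log CR - Real.log ρ) :=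
    mul_pos hζ (sub_pos.mpr (Real.log_lt_log hρ hρC))
  have lower_order := (hq.add (tendsto_natCast_sq_atTop.const_div_atTop
    (Real.log κ - Real.log 2))).sub (tendsto_log_div_sq.const_mul e)
  simp only [mul_zero, add_zero, sub_zero] at lower_order
  filter_upwards [lower_order.eventually (lt_mem_nhds (neg_neg_of_pos gap_pos)),
    eventually_ge_atTop 1] with N hN one_le_N
  have N_pos : (0 : ℝ) < N := by exact_mod_cast one_le_N
  have log_ineq : -(ζ * (Real.log CR - Real.log ρ)) * (N : ℝ) ^ 2 <
      (2 * qα N - 1 / 2) * Real.log (ζ * (N : ℝ) ^ 2) + (Real.log κ - Real.log 2) -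
        e * Real.log N := by
    rw [← lt_div_iff₀ (by positivity)]
    convert hN using 1
    ring
  rw [← Real.log_le_log_iff (by positivity) (by positivity), Real.log_mul (by positivity)
    (by positivity), Real.log_mul (by positivity) (by positivity), Real.log_mul (by positivity)
    (by positivity), Real.log_mul (by positivity) (by positivity), Real.log_rpow hρ,
    Real.log_rpow N_pos, Real.log_rpow (by positivity), Real.log_rpow CR_pos]
  linarith

theorem eventually_nGBSP_le_and_le_nMC {ζ CG CD CR l u ρ : ℝ} {qα : ℕ → ℝ} (p : ℝ) (hζ : 0 < ζ)
    (hCG : 0 ≤ CG) (hCD : 0 < CD) (hl : 0 < l) (hlu : l ≤ u) (hq : Dominates ζ qα) (hρ : 1 ≤ ρ)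
    (hρC : ρ < CR) :
    ∀ᶠ N : ℕ in atTop, ∀ (K : ℕ∞) (ε δ γα γβ qβ : ℝ), 0 < ε → 0 < δ → 0 ≤ γα → 0 ≤ γβ →
      ∀ (B : matrixSpace N) (a : CoeffSpace N K), (B, a) ∈ problemSpace N K →
        B ∈ uniformSpace N K ζ p γα γβ (qα N) qβ CG CD CR →
        CoeffBounds γα γβ (qα N) qβ a → l ≤ coeff a 0 → coeff a 0 ≤ u →
        nGBSP ε δ B a ≤ 1 / (ε ^ 2 * δ) * ((CD + CG * CD / l) * (N : ℝ) ^ (3 + p)) ∧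
        1 / (ε ^ 2 * δ) * ρ ^ (ζ * (N : ℝ) ^ 2) ≤ nMC ε δ B a := by
  have ρ_pos : 0 < ρ := by linarith
  have u_pos : 0 < u := hl.trans_le hlu
  filter_upwards [eventually_two_mul_rpow_le (e := (p + 3) * 2)
    (κ := min 1 l * (Real.exp (1 / 25 - 1 / 6) / √Real.pi) / (CD * (u + CG)) ^ 2)
    hζ (by positivity) hq ρ_pos hρC, eventually_ne_atTop 0]
    with N hN N_ne K ε δ γα γβ qβ hε hδ hγα hγβ B a hP hB ha hla hau
  have : NeZero N := ⟨N_ne⟩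
  exact ⟨nGBSP_le hε hδ hγβ hCG hCD.le hP hB ha hl hla,
    rpow_le_nMC hζ.le hε hδ hγα hγβ hCG hCD (ρ_pos.trans hρC).le hP hB ha hl hla hau hρ hN⟩

end Growth

section SufficientConditions

theorem exp_le_three_pow {N : ℕ} {z : ℝ} (hz : z ≤ N) : Real.exp z ≤ 3 ^ N :=
  calc Real.exp z ≤ Real.exp (N * 1) := Real.exp_le_exp.mpr (by linarith)
    _ = Real.exp 1 ^ N := Real.exp_nat_mul _ _
    _ ≤ 3 ^ N := by
      gcongr
      linarith [Real.exp_one_lt_d9]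

theorem rpow_div_factorial_mul_pow_le_one {N k : ℕ} (hk : 2 ≤ k) {z : ℝ} (hz : 0 ≤ z)
    (hzN : z ≤ N) : (k : ℝ) ^ (-2 * (N : ℝ)) / ((2 * k)! : ℝ) * z ^ (2 * k) ≤ 1 := by
  have rpow_le : (k : ℝ) ^ (-2 * (N : ℝ)) ≤ (4 ^ N)⁻¹ :=
    calc (k : ℝ) ^ (-2 * (N : ℝ)) ≤ 2 ^ (-2 * (N : ℝ)) :=
          Real.rpow_le_rpow_of_nonpos two_pos (by exact_mod_cast hk) (by simp)
      _ = (4 ^ N)⁻¹ := by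
          rw [neg_mul, Real.rpow_neg zero_le_two, Real.rpow_mul zero_le_two, Real.rpow_natCast]
          norm_num
  have pow_le : z ^ (2 * k) / ((2 * k)! : ℝ) ≤ 4 ^ N :=
    calc _ ≤ Real.exp z := Real.pow_div_factorial_le_exp z hz (2 * k)
      _ ≤ 3 ^ N := exp_le_three_pow hzN
      _ ≤ 4 ^ N := by
        gcongr
        norm_num
  calc _ = (k : ℝ) ^ (-2 * (N : ℝ)) * (z ^ (2 * k) / ((2 * k)! : ℝ)) := by ring
    _ ≤ (4 ^ N)⁻¹ * 4 ^ N := by gcongr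
    _ = 1 := inv_mul_cancel₀ (by positivity)

theorem hFun_le {N : ℕ} (n : ℕ) {z : ℝ} (hz : 0 ≤ z) (hzN : z ≤ N) :
    hFun (-2 * (N : ℝ)) n z ≤ z ^ 2 / 2 + n := by
  rcases n.eq_zero_or_pos with rfl | n_pos
  · simp only [hFun, zero_lt_one, Icc_eq_empty_of_lt, sum_empty, Nat.cast_zero]
    positivity
  rw [hFun, ← add_sum_Ioc_eq_sum_Icc n_pos]
  gcongr
  · norm_num
    linarith
  · calc _ ≤ #(Ioc 1 n) • (1 : ℝ) := sum_le_card_nsmul _ _ _ fun k hk =>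
          rpow_div_factorial_mul_pow_le_one (mem_Ioc.mp hk).1 hz hzN
      _ ≤ n := by simp

theorem polylog_le_mul_pow {s : ℝ} (hs : 0 ≤ s) (n : ℕ) {y c : ℝ} (hy : 0 ≤ y) (hyc : y ≤ c)
    (hc : 1 ≤ c) : polylog s n y ≤ n * c ^ n := by
  refine polylog_le_of_forall_sum_le s hy fun M hM => ?_
  have M_le : M ≤ n := by exact_mod_cast hM
  calc ∑ k ∈ Icc 1 M, y ^ k / (k : ℝ) ^ s ≤ #(Icc 1 M) • c ^ n := by
        refine sum_le_card_nsmul _ _ _ fun k hk => ?_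
        rw [mem_Icc] at hk
        calc y ^ k / (k : ℝ) ^ s ≤ y ^ k :=
              div_le_self (by positivity) (Real.one_le_rpow (by exact_mod_cast hk.1) hs)
          _ ≤ c ^ k := by gcongr
          _ ≤ c ^ n := pow_le_pow_right₀ hc (hk.2.trans M_le)
    _ ≤ n * c ^ n := by
        rw [Nat.card_Icc, Nat.add_sub_cancel, nsmul_eq_mul]
        gcongr

theorem polylog_le_geometric {s : ℝ} (hs : 0 ≤ s) (K : ℕ∞) {y c : ℝ} (hy : 0 ≤ y) (hyc : y ≤ c)
    (hc : c < 1) : polylog s K y ≤ (1 - c)⁻¹ := by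
  have c_nonneg : 0 ≤ c := hy.trans hyc
  refine polylog_le_of_forall_sum_le s hy fun M _ => ?_
  calc ∑ k ∈ Icc 1 M, y ^ k / (k : ℝ) ^ s ≤ ∑ k ∈ Icc 1 M, c ^ k := by
        refine sum_le_sum fun k hk => ?_
        have one_le_rpow : 1 ≤ (k : ℝ) ^ s :=
          Real.one_le_rpow (by exact_mod_cast (mem_Icc.mp hk).1) hs
        exact (div_le_self (by positivity) one_le_rpow).trans (by gcongr)
    _ ≤ ∑' k : ℕ, c ^ k := (summable_geometric_of_lt_one c_nonneg hc).sum_le_tsum _ fun k _ => by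
        positivity
    _ = (1 - c)⁻¹ := tsum_geometric_of_lt_one c_nonneg hc

theorem gFun_prefactor_le {N : ℕ} (hN : 14 ≤ N) :
    (2 : ℝ) ^ (((N : ℝ) - 1) / 2 - min (-2 * (N : ℝ)) 0) * Real.pi ^ (((N : ℝ) - 1) / 2) *
      (N : ℝ) ^ (-2 * (N : ℝ) - 1 / 2) * Real.exp ((N : ℝ) / 12) ≤ (2 ^ N)⁻¹ := by
  have N_ge : (14 : ℝ) ≤ N := by exact_mod_cast hN
  have two_rpow_le : (2 : ℝ) ^ (((N : ℝ) - 1) / 2 - min (-2 * (N : ℝ)) 0) ≤ 8 ^ N := by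
    rw [min_eq_left (by linarith)]
    calc (2 : ℝ) ^ (((N : ℝ) - 1) / 2 - -2 * (N : ℝ)) ≤ 2 ^ (3 * (N : ℝ)) :=
          Real.rpow_le_rpow_of_exponent_le one_le_two (by linarith)
      _ = 8 ^ N := by
          rw [Real.rpow_mul zero_le_two, Real.rpow_natCast]
          norm_num
  have pi_rpow_le : Real.pi ^ (((N : ℝ) - 1) / 2) ≤ 4 ^ N :=
    calc Real.pi ^ (((N : ℝ) - 1) / 2) ≤ Real.pi ^ (N : ℝ) :=
          Real.rpow_le_rpow_of_exponent_le (by linarith [Real.pi_gt_three]) (by linarith)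
      _ = Real.pi ^ N := Real.rpow_natCast _ _
      _ ≤ 4 ^ N := by
          gcongr
          exact Real.pi_le_four
  have natCast_rpow_le : (N : ℝ) ^ (-2 * (N : ℝ) - 1 / 2) ≤ (((N : ℝ) ^ 2) ^ N)⁻¹ :=
    calc (N : ℝ) ^ (-2 * (N : ℝ) - 1 / 2) ≤ (N : ℝ) ^ (-(2 * (N : ℝ))) :=
          Real.rpow_le_rpow_of_exponent_le (by linarith) (by linarith)
      _ = _ := by rw [Real.rpow_neg N.cast_nonneg, Real.rpow_mul N.cast_nonneg,
          Real.rpow_natCast, Real.rpow_two]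
  calc _ ≤ (8 : ℝ) ^ N * 4 ^ N * (((N : ℝ) ^ 2) ^ N)⁻¹ * 3 ^ N := by
        gcongr
        exact exp_le_three_pow (by linarith)
    _ = (96 / (N : ℝ) ^ 2) ^ N := by
        rw [← inv_pow, ← mul_pow, ← mul_pow, ← mul_pow]
        ring
    _ ≤ (1 / 2) ^ N := by
        gcongr ?_ ^ N
        rw [div_le_iff₀ (by positivity)]
        nlinarith
    _ = (2 ^ N)⁻¹ := by rw [one_div, inv_pow]

theorem gFun_lt {N : ℕ} (hN : 14 ≤ N) (K : ℕ∞) {z : ℝ} (hz : 0 ≤ z) (hzN : z ≤ 0.95 * N) :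
    gFun (-2 * (N : ℝ)) K N z < (N : ℝ) ^ 3 := by
  have N_ge : (14 : ℝ) ≤ N := by exact_mod_cast hN
  have N_pos : (0 : ℝ) < N := by linarith
  have div_le : z / N ≤ 0.95 := (div_le_iff₀ N_pos).mpr hzN
  have pow_div_pow_le : z ^ N / (N : ℝ) ^ N ≤ 0.95 := by
    rw [← div_pow]
    exact (pow_le_of_le_one (by positivity) (by linarith) (by lia)).trans div_le
  have polylog_zero_le : polylog 0 N (2 * z / N) ≤ N * 2 ^ N :=
    polylog_le_mul_pow le_rfl N (by positivity) (by linarith [mul_div_assoc 2 z (N : ℝ)])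
      one_le_two
  have polylog_pow_le :
      polylog (1 / 2 - (N : ℝ) / 2 - -2 * (N : ℝ)) (sENat N K) (z ^ N / (N : ℝ) ^ N) ≤ 20 := by
    refine (polylog_le_geometric (by linarith) _ (by positivity) pow_div_pow_le
      (by norm_num)).trans ?_
    norm_num
  calc _ ≤ z ^ 2 / 2 + ((N / 2 : ℕ) : ℝ) + (2 ^ N)⁻¹ * (N * 2 ^ N) * 20 := by
        rw [gFun]
        gcongr
        · exact hFun_le _ hz (by linarith)
        · exact polylog_nonneg _ (by positivity)
        · exact polylog_nonneg _ (by positivity)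
        · exact gFun_prefactor_le hN
    _ ≤ (N : ℝ) ^ 2 / 2 + N / 2 + N * 20 := by
        rw [inv_mul_eq_div, mul_div_cancel_right₀ _ (by positivity)]
        gcongr
        · linarith
        · exact Nat.cast_div_le
    _ < (N : ℝ) ^ 3 := by nlinarith [mul_pos N_pos N_pos]

theorem natCast_ceil_rpow_le {T m : ℝ} (hT : 0 < T) (hm : 0 ≤ m) (hmT : m ≤ T) :
    (⌈T⌉₊ : ℝ) ^ m ≤ T ^ m * Real.exp 1 := by
  have ceil_le : (⌈T⌉₊ : ℝ) ≤ T * Real.exp (1 / T) :=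
    calc (⌈T⌉₊ : ℝ) ≤ T + 1 := (Nat.ceil_lt_add_one hT.le).le
      _ = T * (1 / T + 1) := by field_simp; ring
      _ ≤ T * Real.exp (1 / T) := by
        gcongr
        exact Real.add_one_le_exp _
  calc (⌈T⌉₊ : ℝ) ^ m ≤ (T * Real.exp (1 / T)) ^ m := by gcongr
    _ = T ^ m * Real.exp (m / T) := by
      rw [Real.mul_rpow hT.le (Real.exp_pos _).le, ← Real.exp_mul, one_div_mul_eq_div]
    _ ≤ T ^ m * Real.exp 1 := by
      gcongr
      exact (div_le_one hT).mpr hmT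

theorem mul_pow_div_rpow_le_rFun {q x : ℝ} {K k : ℕ} (hq : q < 0) (hx : 0 ≤ x) (hk : 1 ≤ k)
    (hkK : k ≤ K) :
    1 / (2 * √Real.pi) * (x ^ k / (k : ℝ) ^ (1 / 2 - 2 * q)) ≤ rFun q K x := by
  rw [rFun, if_neg hq.not_ge]
  gcongr
  simpa using sum_le_polylog (1 / 2 - 2 * q) (K := K) (F := {k}) hx (by simp) (by simp [hk, hkK])

theorem lt_rFun {T q ρ c x : ℝ} {K : ℕ} (hT : 0 < T) (hTK : T ≤ K) (hq : q < 0)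
    (hqT : 1 / 2 - 2 * q ≤ T) (hρ : 0 < ρ) (hc : 1 ≤ c) (hρc : Real.exp 1 * ρ ^ T < c ^ T)
    (hx : c ≤ x) :
    1 / (2 * √Real.pi) * T ^ (2 * q - 1 / 2) * ρ ^ T < rFun q K x := by
  have ceil_pos : 0 < ⌈T⌉₊ := Nat.ceil_pos.mpr hT
  have pow_lt : Real.exp 1 * ρ ^ T < x ^ ⌈T⌉₊ :=
    calc Real.exp 1 * ρ ^ T < c ^ T := hρc
      _ ≤ c ^ (⌈T⌉₊ : ℝ) := Real.rpow_le_rpow_of_exponent_le hc (Nat.le_ceil T)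
      _ = c ^ ⌈T⌉₊ := Real.rpow_natCast _ _
      _ ≤ x ^ ⌈T⌉₊ := by gcongr
  refine lt_of_lt_of_le ?_ (mul_pow_div_rpow_le_rFun hq (by linarith) ceil_pos
    (Nat.ceil_le.mpr hTK))
  rw [mul_assoc]
  gcongr
  rw [lt_div_iff₀ (by positivity), ← neg_sub (1 / 2), Real.rpow_neg hT.le]
  calc (T ^ (1 / 2 - 2 * q))⁻¹ * ρ ^ T * (⌈T⌉₊ : ℝ) ^ (1 / 2 - 2 * q)
      ≤ (T ^ (1 / 2 - 2 * q))⁻¹ * ρ ^ T * (T ^ (1 / 2 - 2 * q) * Real.exp 1) := by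
        gcongr
        exact natCast_ceil_rpow_le hT (by linarith) hqT
    _ = Real.exp 1 * ρ ^ T := by field_simp
    _ < x ^ ⌈T⌉₊ := pow_lt

theorem eventually_lt_rFun {ζ ρ c : ℝ} (hζ : 0 < ζ) (hρ : 0 < ρ) (hρc : ρ < c) (hc : 1 ≤ c) :
    ∀ᶠ N : ℕ in atTop, ∀ K : ℕ, ζ * (N : ℝ) ^ 2 ≤ K → ∀ x : ℝ, c ≤ x →
      1 / (2 * √Real.pi) * (ζ * (N : ℝ) ^ 2) ^ (2 * (-2 * (N : ℝ)) - 1 / 2) *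
        ρ ^ (ζ * (N : ℝ) ^ 2) < rFun (-2 * (N : ℝ)) K x := by
  have tendsto_rpow : Tendsto (fun N : ℕ => (c / ρ) ^ (ζ * (N : ℝ) ^ 2)) atTop atTop :=
    (tendsto_rpow_atTop_of_base_gt_one _ ((one_lt_div hρ).mpr hρc)).comp
      (tendsto_natCast_sq_atTop.const_mul_atTop hζ)
  filter_upwards [tendsto_rpow.eventually_gt_atTop (Real.exp 1), eventually_ge_atTop 1,
    tendsto_natCast_atTop_atTop.eventually_ge_atTop (5 / ζ)] with N hexp one_le hN K hK x hx
  have one_le_N : (1 : ℝ) ≤ N := by exact_mod_cast one_le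
  rw [div_le_iff₀ hζ] at hN
  rw [Real.div_rpow (hρ.trans hρc).le hρ.le, lt_div_iff₀ (by positivity)] at hexp
  exact lt_rFun (by positivity) hK (by linarith) (by nlinarith) hρ hc hexp hx

theorem one_sub_sum_le_prod_one_sub {ι R : Type*} [CommRing R] [PartialOrder R] [IsOrderedRing R]
    (s : Finset ι) {f : ι → R} (h₀ : ∀ i ∈ s, 0 ≤ f i) (h₁ : ∀ i ∈ s, f i ≤ 1) :
    1 - ∑ i ∈ s, f i ≤ ∏ i ∈ s, (1 - f i) := by
  induction s using Finset.cons_induction with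
  | empty => simp
  | cons a s ha ih =>
    rw [forall_mem_cons] at h₀ h₁
    rw [sum_cons, prod_cons]
    calc 1 - (f a + ∑ i ∈ s, f i) ≤ 1 - (f a + ∑ i ∈ s, f i) + f a * ∑ i ∈ s, f i :=
          le_add_of_nonneg_right (mul_nonneg h₀.1 (sum_nonneg h₀.2))
      _ = (1 - f a) * (1 - ∑ i ∈ s, f i) := by ring
      _ ≤ (1 - f a) * ∏ i ∈ s, (1 - f i) :=
          mul_le_mul_of_nonneg_left (ih h₀.2 h₁.2) (sub_nonneg.mpr h₁.1)

theorem one_sub_trace_le_gbsD {N : ℕ} (B : matrixSpace N) : 1 - B.1.trace ≤ gbsD B := by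
  have trace_eq := (matrixSpace_isHermitian B).trace_eq_sum_eigenvalues
  simp only [RCLike.ofReal_real_eq_id, id] at trace_eq
  rw [trace_eq]
  refine (one_sub_sum_le_prod_one_sub univ (fun i _ => (eigenvalues_mem_Ioo B i).1.le)
    fun i _ => (eigenvalues_mem_Ioo B i).2.le).trans ?_
  refine prod_le_prod (fun i _ => sub_nonneg.mpr (eigenvalues_mem_Ioo B i).2.le) fun i _ => ?_
  obtain ⟨eig_pos, eig_lt_one⟩ := eigenvalues_mem_Ioo B i
  exact Real.le_sqrt_of_sq_le (by nlinarith)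

theorem eventually_mem_uniformSpace {ζ p : ℝ} (hζ : 0 < ζ) (hp : 0 ≤ p) :
    ∀ᶠ N : ℕ in atTop, ∀ K : ℕ, ζ * (N : ℝ) ^ 2 ≤ K → ∀ B : matrixSpace N,
      (∀ i j, 0.9 / (N : ℝ) ≤ B.1 i j) → B.1.trace < 0.97 →
      B ∈ uniformSpace N K ζ p (0.3 * N) (0.4 * N) (-2 * (N : ℝ)) (-2 * (N : ℝ)) 1 34 1.05 := by
  filter_upwards [eventually_ge_atTop 14, eventually_lt_rFun (ρ := 1.05) (c := 1.08) hζ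
    (by norm_num) (by norm_num) (by norm_num)] with N hN lt_rFun K hK B le_entry trace_lt
  have : NeZero N := ⟨by lia⟩
  have N_ge : (14 : ℝ) ≤ N := by exact_mod_cast hN
  have le_bmin : 0.9 ≤ bmin B * N := (div_le_iff₀ (by linarith)).mp (le_bmin B le_entry)
  refine ⟨by simp, ?_, lt_rFun K hK _ (by linarith), ?_⟩
  · rw [one_mul]
    refine gFun_lt hN K (Real.sqrt_nonneg _) ?_
    rw [Real.sqrt_le_left (by positivity), ← div_eq_mul_inv, div_le_iff₀ (bmin_pos B)]
    nlinarith
  · have lt_gbsD : 0.03 < gbsD B := by linarith [one_sub_trace_le_gbsD B]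
    have one_le_rpow : 1 ≤ (N : ℝ) ^ p := Real.one_le_rpow (by linarith) hp
    rw [div_lt_iff₀ (gbsD_pos B)]
    nlinarith

theorem uniformSpace_anti {N : ℕ} {K : ℕ∞} {ζ p γα γβ qα qβ CG CD CR CR' : ℝ} (hζ : 0 ≤ ζ)
    (hCR : 0 ≤ CR) (h : CR ≤ CR') :
    uniformSpace N K ζ p γα γβ qα qβ CG CD CR' ⊆ uniformSpace N K ζ p γα γβ qα qβ CG CD CR := by
  rintro B ⟨domain, gFun_lt, lt_rFun, gbsD_lt⟩
  refine ⟨domain, gFun_lt, lt_of_le_of_lt ?_ lt_rFun, gbsD_lt⟩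
  gcongr

theorem dominates_mul_natCast {ζ : ℝ} (hζ : 0 < ζ) (c : ℝ) :
    Dominates ζ fun N => c * (N : ℝ) := by
  have log_div : Tendsto (fun N : ℕ => Real.log N / (N : ℝ)) atTop (𝓝 0) := by
    have := (isLittleO_log_rpow_atTop (r := 1) zero_lt_one).tendsto_div_nhds_zero
    simp only [Real.rpow_one] at this
    exact this.comp tendsto_natCast_atTop_atTop
  have inv : Tendsto (fun N : ℕ => 1 / (N : ℝ)) atTop (𝓝 0) :=
    tendsto_one_div_atTop_nhds_zero_nat
  have product := ((inv.const_mul (-1 / 2)).const_add (2 * c)).mul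
    ((inv.const_mul (Real.log ζ)).add (log_div.const_mul 2))
  simp only [mul_zero, add_zero] at product
  refine product.congr' ?_
  filter_upwards [eventually_ne_atTop 0] with N hN
  have N_ne : (N : ℝ) ≠ 0 := by exact_mod_cast hN
  rw [Real.log_mul hζ.ne' (by positivity), Real.log_pow, Nat.cast_two]
  field_simp
  ring

end SufficientConditions

section OpenFamily

variable {N : ℕ}

/-- The matrix with `0.96 / N` on the diagonal and `0.91 / N` elsewhere: all its entries are of
order `1 / N`, while its trace, hence its largest eigenvalue, stays below `1`. -/
noncomputable def flatMatrix (N : ℕ) : Matrix (Fin N) (Fin N) ℝ :=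
  (0.91 / (N : ℝ)) • Matrix.vecMulVec (fun _ => 1) (fun _ => 1) + (0.05 / (N : ℝ)) • 1

theorem flatMatrix_apply (i j : Fin N) :
    flatMatrix N i j = 0.91 / (N : ℝ) + if i = j then 0.05 / (N : ℝ) else 0 := by
  simp [flatMatrix, Matrix.vecMulVec_apply, Matrix.one_apply]

theorem le_flatMatrix_apply (i j : Fin N) : 0.91 / (N : ℝ) ≤ flatMatrix N i j := by
  rw [flatMatrix_apply, le_add_iff_nonneg_right]
  positivity

section NeZero

variable [NeZero N]

theorem trace_flatMatrix : (flatMatrix N).trace = 0.96 := by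
  have N_ne : (N : ℝ) ≠ 0 := NeZero.ne _
  simp only [Matrix.trace, Matrix.diag_apply, flatMatrix_apply, if_true, sum_const, card_univ,
    Fintype.card_fin, nsmul_eq_mul]
  field_simp
  norm_num

theorem posDef_flatMatrix : (flatMatrix N).PosDef := by
  have N_pos : (0 : ℝ) < N := by exact_mod_cast NeZero.pos N
  have posSemidef_ones :
      (Matrix.vecMulVec (fun _ => 1) (fun _ => 1) : Matrix (Fin N) (Fin N) ℝ).PosSemidef := by
    simpa [Pi.star_def] using
      Matrix.posSemidef_vecMulVec_self_star (R := ℝ) (fun _ : Fin N => (1 : ℝ))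
  exact Matrix.PosDef.posSemidef_add (posSemidef_ones.smul (by positivity))
    (Matrix.PosDef.one.smul (by positivity))

theorem flatMatrix_mem_matrixSpace : flatMatrix N ∈ matrixSpace N := by
  have N_pos : (0 : ℝ) < N := by exact_mod_cast NeZero.pos N
  have isHermitian := (posDef_flatMatrix (N := N)).isHermitian
  refine ⟨fun i j => lt_of_lt_of_le (by positivity) (le_flatMatrix_apply i j), isHermitian, ?_⟩
  rw [isHermitian.spectrum_real_eq_range_eigenvalues, Set.range_subset_iff]
  refine fun i => ⟨posDef_flatMatrix.eigenvalues_pos i, ?_⟩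
  calc isHermitian.eigenvalues i ≤ ∑ j, isHermitian.eigenvalues j :=
        single_le_sum (fun j _ => (posDef_flatMatrix.eigenvalues_pos j).le) (mem_univ i)
    _ = (flatMatrix N).trace := isHermitian.trace_eq_sum_eigenvalues.symm
    _ < 1 := by norm_num [trace_flatMatrix]

end NeZero

/-- The matrices with entries larger than `0.9 / N` and trace smaller than `0.97`: an open
neighbourhood of `flatMatrix N`. -/
def nearFlat (N : ℕ) : Set (matrixSpace N) :=
  {B | (∀ i j, 0.9 / (N : ℝ) < B.1 i j) ∧ B.1.trace < 0.97}

theorem isOpen_nearFlat : IsOpen (nearFlat N) := by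
  have entries : IsOpen {B : matrixSpace N | ∀ i j, 0.9 / (N : ℝ) < B.1 i j} := by
    simp only [Set.ofPred_forall]
    exact isOpen_iInter_of_finite fun i => isOpen_iInter_of_finite fun j =>
      isOpen_lt continuous_const (continuous_subtype_val.matrix_elem i j)
  exact entries.and (isOpen_lt continuous_subtype_val.matrix_trace continuous_const)

theorem flatMatrix_mem_nearFlat [NeZero N] :
    (⟨flatMatrix N, flatMatrix_mem_matrixSpace⟩ : matrixSpace N) ∈ nearFlat N := by
  have N_pos : (0 : ℝ) < N := by exact_mod_cast NeZero.pos N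
  refine ⟨fun i j => lt_of_lt_of_le ?_ (le_flatMatrix_apply i j), ?_⟩
  · gcongr
    norm_num
  · norm_num [trace_flatMatrix]

/-- The most evenly distributed multi-index of degree `2k`: its first `r_k` entries are `s_k + 1`,
the others `s_k`. It minimizes `I!`, and `mNum N k` is that minimum. -/
def balanced (N k : ℕ) (i : Fin N) : ℕ := sNum N k + if (i : ℕ) < rNum N k then 1 else 0

section Balanced

variable [NeZero N] {k : ℕ}

theorem card_lt_rNum (hk : 1 ≤ k) : #{i : Fin N | (i : ℕ) < rNum N k} = rNum N k := by
  rw [Fin.card_filter_val_lt, min_eq_right (sNum_rNum_spec NeZero.one_le hk).2.2]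

theorem balanced_mem_level (k : ℕ) : balanced N k ∈ level N k := by
  rw [mem_level]
  rcases k.eq_zero_or_pos with rfl | k_pos
  · simp [balanced, sNum, rNum]
  simp only [balanced]
  rw [sum_add_distrib, sum_const, ← card_filter, card_lt_rNum k_pos, card_univ,
    Fintype.card_fin, smul_eq_mul]
  exact (sNum_rNum_spec NeZero.one_le k_pos).1.symm

theorem mfact_balanced (hk : 1 ≤ k) : mfact (balanced N k) = mNum N k := by
  have factorial_eq (i : Fin N) : ((balanced N k i)! : ℝ) =
      ((sNum N k)! : ℝ) * if (i : ℕ) < rNum N k then (sNum N k : ℝ) + 1 else 1 := by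
    rw [balanced]
    split_ifs
    · rw [Nat.factorial_succ, Nat.cast_mul, Nat.cast_succ, mul_comm]
    · rw [add_zero, mul_one]
  simp only [mfact, mNum, factorial_eq]
  rw [prod_mul_distrib, ← prod_filter, prod_const, prod_const, card_lt_rNum hk, card_univ,
    Fintype.card_fin]

end Balanced

theorem mNum_pos (N k : ℕ) : 0 < mNum N k := by
  rw [mNum]
  positivity

open Classical in
/-- The coefficient family supported on the balanced multi-indices, with value `v k` in degree
`2k`. -/
noncomputable def balancedCoeff (N : ℕ) (K : ℕ∞) (v : ℕ → ℝ≥0) : CoeffSpace N K :=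
  fun I => if I.1 = balanced N ((∑ i, I.1 i) / 2) then v ((∑ i, I.1 i) / 2) else 0

section BalancedCoeff

variable {K : ℕ∞} {k : ℕ}

open Classical in
theorem coeff_balancedCoeff (v : ℕ → ℝ≥0) (hk : (k : ℕ∞) ≤ K) {I : Fin N → ℕ}
    (hI : I ∈ level N k) :
    coeff (balancedCoeff N K v) I = if I = balanced N k then (v k : ℝ) else 0 := by
  rw [mem_level] at hI
  rw [coeff, dif_pos ⟨k, hk, hI⟩]
  simp only [balancedCoeff, hI, Nat.mul_div_cancel_left k two_pos]
  split_ifs <;> rfl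

variable [NeZero N]

theorem sum_level_balancedCoeff (v : ℕ → ℝ≥0) (hk : (k : ℕ∞) ≤ K) (g : (Fin N → ℕ) → ℝ) :
    ∑ I ∈ level N k, coeff (balancedCoeff N K v) I * g I = v k * g (balanced N k) := by
  classical
  calc _ = ∑ I ∈ level N k, if I = balanced N k then v k * g I else 0 :=
        sum_congr rfl fun I hI => by rw [coeff_balancedCoeff v hk hI, ite_mul, zero_mul]
    _ = _ := by rw [sum_ite_eq', if_pos (balanced_mem_level k)]

theorem coeff_balancedCoeff_zero (v : ℕ → ℝ≥0) : coeff (balancedCoeff N K v) 0 = v 0 := by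
  simpa [level_zero] using
    sum_level_balancedCoeff (K := K) (k := 0) v (by simp) (fun _ : Fin N → ℕ => (1 : ℝ))

end BalancedCoeff

theorem continuous_coeff {K : ℕ∞} (I : Fin N → ℕ) :
    Continuous fun a : CoeffSpace N K => coeff a I := by
  simp only [coeff]
  split_ifs
  · exact NNReal.continuous_coe.comp (continuous_apply _)
  · exact continuous_const

/-- The coefficient families with `l < a₀ < u` that satisfy the conditions of `CoeffBounds` with
strict inequalities, so that for finite `K` they form an open set. -/
def strictCoeffs (N : ℕ) (K : ℕ∞) (l u γα γβ qα qβ : ℝ) : Set (CoeffSpace N K) :=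
  {a | coeff a 0 ∈ Set.Ioo l u ∧ ∀ k : ℕ, 1 ≤ k ∧ (k : ℕ∞) ≤ K →
    (k : ℝ) ^ qα * γα ^ k / (k ! : ℝ) < ∑ I ∈ level N k, coeff a I ∧
    ∑ I ∈ level N k, coeff a I < (k : ℝ) ^ qβ * γβ ^ k / (k ! : ℝ) ∧
    ∑ I ∈ level N k, coeff a I * mfact I < (k : ℝ) ^ qβ * γβ ^ k / (k ! : ℝ) * mNum N k}

theorem coeffBounds_of_mem_strictCoeffs {K : ℕ∞} {l u γα γβ qα qβ : ℝ} {a : CoeffSpace N K}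
    (ha : a ∈ strictCoeffs N K l u γα γβ qα qβ) : CoeffBounds γα γβ qα qβ a := fun k hk hkK =>
  have ⟨lower, upper, upper_mfact⟩ := ha.2 k ⟨hk, hkK⟩
  ⟨lower.le, upper.le, upper_mfact.le⟩

theorem isOpen_strictCoeffs (K : ℕ) (l u γα γβ qα qβ : ℝ) :
    IsOpen (strictCoeffs N K l u γα γβ qα qβ) := by
  have finite : {k : ℕ | 1 ≤ k ∧ (k : ℕ∞) ≤ K}.Finite :=
    (Set.finite_Icc 1 K).subset fun k hk => ⟨hk.1, by exact_mod_cast hk.2⟩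
  have continuous_sum (k : ℕ) :
      Continuous fun a : CoeffSpace N K => ∑ I ∈ level N k, coeff a I :=
    continuous_finsetSum _ fun I _ => continuous_coeff I
  have continuous_sum_mfact (k : ℕ) :
      Continuous fun a : CoeffSpace N K => ∑ I ∈ level N k, coeff a I * mfact I :=
    continuous_finsetSum _ fun I _ => (continuous_coeff I).mul continuous_const
  refine (isOpen_Ioo.preimage (continuous_coeff 0)).and ?_
  simp only [Set.ofPred_forall]
  exact finite.isOpen_biInter fun k _ => (isOpen_lt continuous_const (continuous_sum k)).and <|
    (isOpen_lt (continuous_sum k) continuous_const).and <|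
      isOpen_lt (continuous_sum_mfact k) continuous_const

theorem exists_mem_strictCoeffs [NeZero N] (K : ℕ∞) {l u γα γβ : ℝ} (q : ℝ) (hγα : 0 ≤ γα)
    (hγ : γα < γβ) {t : ℝ≥0} (ht : (t : ℝ) ∈ Set.Ioo l u) :
    ∃ a ∈ strictCoeffs N K l u γα γβ q q, coeff a 0 = t := by
  obtain ⟨γ, γα_lt, lt_γβ⟩ := exists_between hγ
  have γ_pos : 0 < γ := hγα.trans_lt γα_lt
  let v (k : ℕ) : ℝ≥0 := if k = 0 then t else ((k : ℝ) ^ q * γ ^ k / (k ! : ℝ)).toNNReal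
  have coeff_zero : coeff (balancedCoeff N K v) 0 = t := by simp [coeff_balancedCoeff_zero, v]
  refine ⟨balancedCoeff N K v, ⟨coeff_zero ▸ ht, fun k ⟨one_le, le_K⟩ => ?_⟩, coeff_zero⟩
  have k_ne : k ≠ 0 := by lia
  have v_eq : (v k : ℝ) = (k : ℝ) ^ q * γ ^ k / (k ! : ℝ) := by
    simp only [v, if_neg k_ne]
    exact Real.coe_toNNReal _ (by positivity)
  have sum_eq := sum_level_balancedCoeff (N := N) v le_K fun _ => 1
  simp only [mul_one] at sum_eq
  rw [sum_eq, sum_level_balancedCoeff v le_K, mfact_balanced one_le, v_eq]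
  have mNum_pos := mNum_pos N k
  refine ⟨?_, ?_, ?_⟩ <;> gcongr

theorem mem_problemSpace [NeZero N] {K : ℕ} (B : matrixSpace N) {a : CoeffSpace N K}
    (ha : 0 < coeff a 0) : (B, a) ∈ problemSpace N K := by
  classical
  let L : Finset (Fin N → ℕ) := (range (K + 1)).biUnion (level N)
  have coeff_eq_zero (I : Fin N → ℕ) (hI : I ∉ L) : coeff a I = 0 := by
    contrapose! hI
    obtain ⟨k, hk, sum_eq⟩ := exists_of_coeff_ne_zero hI
    exact mem_biUnion.mpr ⟨k, mem_range_succ_iff.mpr (by exact_mod_cast hk), mem_level.mpr sum_eq⟩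
  have summable_mu : Summable fun I : Fin N → ℕ => coeff a I * hafB B.1 I :=
    summable_of_ne_finset_zero (s := L) fun I hI => by rw [coeff_eq_zero I hI, zero_mul]
  refine ⟨summable_mu, (ha.trans_le (coeff_zero_le_muHaf summable_mu)).ne',
    summable_of_ne_finset_zero (s := L) fun I hI => by simp [coeff_eq_zero I hI],
    summable_of_ne_finset_zero (s := L ×ˢ L) fun p hp => ?_⟩
  rw [mem_product, not_and_or] at hp
  rcases hp with hp | hp <;> simp [coeff_eq_zero _ hp]

/-- The problems given by a matrix in `nearFlat N` and coefficients in `strictCoeffs` for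
`γ_α = 0.3 N`, `γ_β = 0.4 N` and `q_α = q_β = -2 N`. The numerical constants are chosen such that
`4 γ_α b_min > 1.08`, `√(2 γ_β / b_min) < 0.95 N` and `1 / d < 34` hold throughout. -/
def openFamily (N K : ℕ) (l u : ℝ) : Set (problemSpace N K) :=
  Subtype.val ⁻¹'
    (nearFlat N ×ˢ strictCoeffs N K l u (0.3 * N) (0.4 * N) (-2 * (N : ℝ)) (-2 * (N : ℝ)))

theorem isOpen_openFamily (N K : ℕ) (l u : ℝ) : IsOpen (openFamily N K l u) :=
  (isOpen_nearFlat.prod (isOpen_strictCoeffs K l u _ _ _ _)).preimage continuous_subtype_val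

theorem exists_mem_openFamily [NeZero N] (K : ℕ) {l u t : ℝ} (ht : t ∈ Set.Ioo l u)
    (t_pos : 0 < t) : ∃ x ∈ openFamily N K l u, coeff x.1.2 0 = t := by
  have N_pos : (0 : ℝ) < N := by exact_mod_cast NeZero.pos N
  lift t to ℝ≥0 using t_pos.le
  obtain ⟨a, ha, coeff_zero⟩ := exists_mem_strictCoeffs (N := N) (K := K) (γα := 0.3 * N)
    (γβ := 0.4 * N) (-2 * (N : ℝ)) (by positivity) (by linarith) ht
  exact ⟨⟨_, mem_problemSpace _ (coeff_zero ▸ t_pos)⟩, ⟨flatMatrix_mem_nearFlat, ha⟩, coeff_zero⟩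

theorem eventually_bounds_of_mem_openFamily {ζ p l u : ℝ} (hζ : 0 < ζ) (hp : 0 ≤ p) (hl : 0 < l)
    (hlu : l ≤ u) :
    ∀ᶠ N : ℕ in atTop, ∀ K : ℕ, ζ * (N : ℝ) ^ 2 ≤ K → ∀ x ∈ openFamily N K l u,
      x.1.1 ∈ uniformSpace N K ζ p (0.3 * N) (0.4 * N) (-2 * (N : ℝ)) (-2 * (N : ℝ)) 1 34 1.02 ∧
      CoeffBounds (0.3 * (N : ℝ)) (0.4 * N) (-2 * (N : ℝ)) (-2 * (N : ℝ)) x.1.2 ∧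
      l < coeff x.1.2 0 ∧ coeff x.1.2 0 < u ∧
      ∀ ε δ : ℝ, 0 < ε → 0 < δ →
        nGBSP ε δ x.1.1 x.1.2 ≤ 1 / (ε ^ 2 * δ) * ((34 + 34 / l) * (N : ℝ) ^ (3 + p)) ∧
        1 / (ε ^ 2 * δ) * 1.02 ^ (ζ * (N : ℝ) ^ 2) ≤ nMC ε δ x.1.1 x.1.2 := by
  filter_upwards [eventually_mem_uniformSpace hζ hp,
    eventually_nGBSP_le_and_le_nMC (CG := 1) (CD := 34) (CR := 1.05) (ρ := 1.02) p hζ zero_le_one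
      (by norm_num) hl hlu (dominates_mul_natCast hζ (-2)) (by norm_num) (by norm_num)]
    with N mem_uniform sampleSizes K hK x ⟨⟨le_entry, trace_lt⟩, ha⟩
  have mem_uniform := mem_uniform K hK x.1.1 (fun i j => (le_entry i j).le) trace_lt
  have coeffBounds := coeffBounds_of_mem_strictCoeffs ha
  obtain ⟨⟨l_lt, lt_u⟩, -⟩ := ha
  refine ⟨uniformSpace_anti hζ.le (by norm_num) (by norm_num) mem_uniform, coeffBounds, l_lt, lt_u,
    fun ε δ hε hδ => ?_⟩
  simpa only [one_mul] using sampleSizes K ε δ _ _ _ hε hδ (by positivity) (by positivity) x.1.1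
    x.1.2 x.2 mem_uniform coeffBounds l_lt.le lt_u.le

end OpenFamily

end GBS

theorem mainTheorem6 :
    -- the explicit bounds, for each single `N`
    (∀ (N : ℕ) (K : ℕ∞) (ζ p ε δ γα γβ qα qβ CG CD CR : ℝ),
      1 ≤ N → 0 < ζ → LargeDegree ζ N K → 0 < p → 0 < ε → ε < 1 → 0 < δ → δ < 1 →
      0 < γα → 0 < γβ → 0 < CG → 0 < CD → 1 < CR →
      ∀ (B : matrixSpace N) (a : CoeffSpace N K), (B, a) ∈ problemSpace N K →
        B ∈ uniformSpace N K ζ p γα γβ qα qβ CG CD CR →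
        CoeffBounds γα γβ qα qβ a → coeff a 0 ≠ 0 →
        nGBSP ε δ B a <
          1 / (ε ^ 2 * δ) *
            (CD * (N : ℝ) ^ p + CG * CD * (N : ℝ) ^ (3 + p) / coeff a 0 - 1) ∧
        1 / (ε ^ 2 * δ) *
            (min 1 (coeff a 0) * (Real.exp (1 / 25 - 1 / 6) / √Real.pi) *
                (ζ * (N : ℝ) ^ 2) ^ (2 * qα - 1 / 2) * CR ^ (ζ * (N : ℝ) ^ 2) /
              (CD * (N : ℝ) ^ p * (coeff a 0 + CG * (N : ℝ) ^ 3)) ^ 2 - 1) <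
          nMC ε δ B a) ∧
    -- the growth rates along families of problems
    (∀ (ζ p CG CD CR l u : ℝ) (qα : ℕ → ℝ),
      0 < ζ → 0 < p → 0 < CG → 0 < CD → 1 < CR → 0 < l → l ≤ u → Dominates ζ qα →
      ∃ C : ℝ, 0 < C ∧ ∀ ρ : ℝ, 1 < ρ → ρ < CR →
      ∃ (c : ℝ) (N₀ : ℕ), 0 < c ∧ 1 ≤ N₀ ∧
        ∀ (N : ℕ) (K : ℕ∞) (ε δ γα γβ qβ : ℝ),
          N₀ ≤ N → LargeDegree ζ N K → 0 < ε → ε < 1 → 0 < δ → δ < 1 → 0 < γα → 0 < γβ →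
          ∀ (B : matrixSpace N) (a : CoeffSpace N K), (B, a) ∈ problemSpace N K →
            B ∈ uniformSpace N K ζ p γα γβ (qα N) qβ CG CD CR →
            CoeffBounds γα γβ (qα N) qβ a → l ≤ coeff a 0 → coeff a 0 ≤ u →
            nGBSP ε δ B a ≤ 1 / (ε ^ 2 * δ) * (C * (N : ℝ) ^ (3 + p)) ∧
            1 / (ε ^ 2 * δ) * (c * ρ ^ (ζ * (N : ℝ) ^ 2)) ≤ nMC ε δ B a) ∧
    -- for all large `N` there are non-empty open subsets of the problem space of such problems
    (∀ ζ p : ℝ, 0 < ζ → 0 < p →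
      ∃ (CG CD CR : ℝ) (γα γβ qα qβ : ℕ → ℝ),
        0 < CG ∧ 0 < CD ∧ 1 < CR ∧ Dominates ζ qα ∧ (∀ N, 1 ≤ N → 0 < γα N ∧ 0 < γβ N) ∧
        ∀ l u : ℝ, 0 < l → l < u →
          ∃ (C c : ℝ) (N₀ : ℕ), 0 < C ∧ 0 < c ∧ 1 ≤ N₀ ∧
            ∀ N K : ℕ, N₀ ≤ N → ζ * (N : ℝ) ^ 2 ≤ (K : ℝ) →
              ∃ U : Set (problemSpace N (K : ℕ∞)), IsOpen U ∧ U.Nonempty ∧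
                (∀ t, l < t → t < u → ∃ x ∈ U, coeff x.1.2 0 = t) ∧
                ∀ x ∈ U,
                  x.1.1 ∈ uniformSpace N (K : ℕ∞) ζ p (γα N) (γβ N) (qα N) (qβ N) CG CD CR ∧
                  CoeffBounds (γα N) (γβ N) (qα N) (qβ N) x.1.2 ∧
                  l < coeff x.1.2 0 ∧ coeff x.1.2 0 < u ∧
                  ∀ ε δ : ℝ, 0 < ε → ε < 1 → 0 < δ → δ < 1 →
                    nGBSP ε δ x.1.1 x.1.2 ≤ 1 / (ε ^ 2 * δ) * (C * (N : ℝ) ^ (3 + p)) ∧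
                    1 / (ε ^ 2 * δ) * (c * CR ^ (ζ * (N : ℝ) ^ 2)) ≤
                      nMC ε δ x.1.1 x.1.2) := by
  refine ⟨fun N K ζ p ε δ γα γβ qα qβ CG CD CR hN hζ _ _ hε _ hδ _ hγα hγβ _ _ hCR B a hP hB ha
    ha0 => ?_, fun ζ p CG CD CR l u qα hζ _ hCG hCD _ hl hlu hq => ?_, fun ζ p hζ hp => ?_⟩
  · have : NeZero N := ⟨by lia⟩
    exact ⟨nGBSP_lt hε hδ hγβ.le hP hB ha ha0,
      lt_nMC hζ.le hε hδ hγα.le hγβ.le (by linarith) hP hB ha ha0⟩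
  · refine ⟨CD + CG * CD / l, by positivity, fun ρ one_lt_ρ ρ_lt => ?_⟩
    obtain ⟨N₀, sampleSizes⟩ := Filter.eventually_atTop.mp
      (eventually_nGBSP_le_and_le_nMC p hζ hCG.le hCD hl hlu hq one_lt_ρ.le ρ_lt)
    refine ⟨1, max 1 N₀, one_pos, le_max_left _ _,
      fun N K ε δ γα γβ qβ hN _ hε _ hδ _ hγα hγβ => ?_⟩
    simpa only [one_mul] using sampleSizes N (by lia) K ε δ γα γβ qβ hε hδ hγα.le hγβ.le
  · refine ⟨1, 34, 1.02, fun N => 0.3 * N, fun N => 0.4 * N, fun N => -2 * N, fun N => -2 * N,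
      one_pos, by norm_num, by norm_num, dominates_mul_natCast hζ (-2),
      fun N hN => ⟨by positivity, by positivity⟩, fun l u hl hlu => ?_⟩
    obtain ⟨N₀, bounds⟩ := Filter.eventually_atTop.mp
      (eventually_bounds_of_mem_openFamily hζ hp.le hl hlu.le)
    refine ⟨34 + 34 / l, 1, max 1 N₀, by positivity, one_pos, le_max_left _ _, fun N K hN hK => ?_⟩
    have : NeZero N := ⟨by lia⟩
    have attained t (l_lt : l < t) (lt_u : t < u) : ∃ x ∈ openFamily N K l u, coeff x.1.2 0 = t :=
      exists_mem_openFamily K ⟨l_lt, lt_u⟩ (hl.trans l_lt)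
    obtain ⟨t, l_lt, lt_u⟩ := exists_between hlu
    obtain ⟨x, hx, -⟩ := attained t l_lt lt_u
    refine ⟨openFamily N K l u, isOpen_openFamily N K l u, ⟨x, hx⟩, attained, fun x hx => ?_⟩
    obtain ⟨mem_uniform, coeffBounds, l_lt, lt_u, sampleSizes⟩ := bounds N (by lia) K hK x hx
    refine ⟨mem_uniform, coeffBounds, l_lt, lt_u, fun ε δ hε _ hδ _ => ?_⟩
    simpa only [one_mul] using sampleSizes ε δ hε hδ
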